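/- Let $A=\{a_j\}_{j=1}^{\infty}$ be a sequence of positive integers (not necessarily distinct). Put $$N_A(x)=\#\{j\in\mathbb N: a_j\le x\},\qquad \mathrm{ord}_A(n)=\#\{j\in\mathbb N: a_j=n\}\ (n\in\mathbb N),\qquad \rho_A(x)=\max_{n\le x}\mathrm{ord}_A(n),$$ where $\mathbb N$ is the set of positive integers and $n$ runs over positive integers. Suppose that $\mathrm{ord}_A(n)<+\infty$ for every positive integer $n$. Suppose that there are constants $\gamma_1>0$, $\gamma_2>0$, $\alpha>0$, $x_0\ge 10$ such that for every real number $x\ge x_0$ we have $$N_A(x)>0,\qquad N_A\Bigl(\frac x2\Bigr)\ge\gamma_1 N_A(x),$$ $$\sum_{\substack{k\in\mathbb N:\\ a_k<x}}\ \sum_{\substack{p\text{ prime}\\ p\le(\ln x)^{\alpha}}}\frac{\#\{j\in\mathbb N: a_k<a_j\le x\text{ and }a_j\equiv a_k\ (\mathrm{mod}\ p)\}\,\ln p}{p}\le\gamma_2\,(N_A(x))^2 .$$ For a positive integer $n$ let $r(n)=\#\{(p,j): p\text{ prime},\ j\in\mathbb N,\ p+a_j=n\}$. Then there are constants $c_1=c_1(\gamma_1)>0$,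 depending only on $\gamma_1$, and $c_2=c_2(\gamma_1,\gamma_2,\alpha)>0$, depending only on $\gamma_1,\gamma_2,\alpha$, such that $$\#\Bigl\{1\le n\le x: r(n)\ge c_1\frac{N_A(x)}{\ln x}\Bigr\}\ \ge\ c_2\,x\,\frac{N_A(x)}{N_A(x)+\rho_A(x)\ln x}$$ for every real number $x\ge x_0$. In particular, $$\#\{1\le n\le x: \text{there are a prime } p \text{ and } j\in\mathbb N\text{ such that } p+a_j=n\}\ \ge\ c_2\,x\,\frac{N_A(x)}{N_A(x)+\rho_A(x)\ln x}$$ for every real number $x\ge x_0$. -/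

import Mathlib

namespace Romanoff

/-- The counting function `N_A(x) = #{j : a_j ≤ x}` of a sequence `A = (a_j)`. -/
noncomputable def countUpTo (a : ℕ → ℕ) (x : ℝ) : ℕ :=
  {j : ℕ | (a j : ℝ) ≤ x}.ncard

/-- The multiplicity `ord_A(n) = #{j : a_j = n}`. -/
noncomputable def multiplicity (a : ℕ → ℕ) (n : ℕ) : ℕ :=
  {j : ℕ | a j = n}.ncard

/-- The maximal multiplicity `ρ_A(x) = max_{1 ≤ n ≤ x} ord_A(n)`. -/
noncomputable def maxMultiplicity (a : ℕ → ℕ) (x : ℝ) : ℕ :=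
  (Finset.Icc 1 ⌊x⌋₊).sup (multiplicity a)

/-- The number of `j` with `a_k < a_j ≤ x` and `a_j ≡ a_k (mod p)`. -/
noncomputable def congruenceCount (a : ℕ → ℕ) (x : ℝ) (k p : ℕ) : ℕ :=
  {j : ℕ | a k < a j ∧ (a j : ℝ) ≤ x ∧ a j ≡ a k [MOD p]}.ncard

/-- The double sum, over the indices `k` with `a_k < x` and over the primes `p ≤ (ln x) ^ α`, of
`#{j : a_k < a_j ≤ x, a_j ≡ a_k (mod p)} * ln p / p`. -/
noncomputable def smallPrimeSum (a : ℕ → ℕ) (α x : ℝ) : ℝ :=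
  ∑ᶠ (k : ℕ) (_ : (a k : ℝ) < x),
    ∑ p ∈ (Finset.Icc 1 ⌊(Real.log x) ^ α⌋₊).filter Nat.Prime,
      (congruenceCount a x k p : ℝ) * Real.log p / p

/-- The number `r(n)` of pairs `(p, j)` with `p` prime and `p + a_j = n`. -/
noncomputable def reprCount (a : ℕ → ℕ) (n : ℕ) : ℕ :=
  {q : ℕ × ℕ | q.1.Prime ∧ q.1 + a q.2 = n}.ncard

end Romanoff

/-! The proof is a second moment argument. Write N for the count up to x, ρ for the maximal
multiplicity and L for ln x. Primes and terms not exceeding x/2 have sums at most x, so by Chebyshev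
and the doubling hypothesis the sum of r(n) over n ≤ x is at least of order γ₁ x N / L. If the sum
of r(n)² is of order at most (x N / L²)(N + ρ L), the Cauchy–Schwarz inequality shows that r(n) is
at least a constant times N / L for the claimed number of n.

The second moment counts coincidences p + a_j = q + a_k. Those with a_j = a_k number at most N ρ
π(x). For a_j ≠ a_k and h = |a_j - a_k|, the Selberg sieve (`card_prime_pairs_le`) bounds the number
of prime pairs p, p + h by a constant times (x / L²) F(h), where F(h) is the product of 1 + 1/p over
the primes p dividing h.

It remains to average F over the differences. By `singularFactor_le`, the primes p > L^α dividing h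
change F(h) by a bounded factor only, and the product over the smaller ones is at most 2 + 4 ∑ ln p
/ p. Summed over pairs, this is exactly the quantity controlled by the third hypothesis.

The sieve needs a lower bound of order L² / F(h) for the Selberg sum. It comes from elementary
rearrangements of the square of the harmonic sum (`log_sq_le_singularFactor_mul`). -/

namespace BoundingSieve

/-! ### The Selberg upper bound sieve with a crude remainder. -/

open Finset Nat ArithmeticFunction
open scoped ArithmeticFunction.Moebius

variable (s : BoundingSieve) (z : ℕ)

/-- The divisors of `prodPrimes` up to the level `z`. -/
def truncatedDivisors : Finset ℕ := s.prodPrimes.divisors.filter (· ≤ z)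

/-- The sum of the Selberg terms up to the level `z`. -/
noncomputable def selbergSum : ℝ := ∑ l ∈ s.truncatedDivisors z, s.selbergTerms l

/-- The optimal weights of the Selberg sieve. -/
noncomputable def selbergWeights (d : ℕ) : ℝ :=
  if d ∈ s.truncatedDivisors z then
    (μ d : ℝ) * (s.nu d)⁻¹ * (s.selbergSum z)⁻¹ *
      ∑ l ∈ s.truncatedDivisors z with d ∣ l, s.selbergTerms l
  else 0

variable {s z}

theorem mem_truncatedDivisors {d : ℕ} :
    d ∈ s.truncatedDivisors z ↔ d ∣ s.prodPrimes ∧ d ≤ z := by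
  simp [truncatedDivisors, prodPrimes_ne_zero]

theorem selbergTerms_pos_of_mem {d : ℕ} (hd : d ∈ s.truncatedDivisors z) :
    0 < s.selbergTerms d :=
  selbergTerms_pos (mem_truncatedDivisors.1 hd).1

theorem selbergSum_pos (hz : 1 ≤ z) : 0 < s.selbergSum z :=
  sum_pos (fun _ hd => selbergTerms_pos_of_mem hd)
    ⟨1, mem_truncatedDivisors.2 ⟨one_dvd _, hz⟩⟩

theorem selbergWeights_one (hz : 1 ≤ z) : s.selbergWeights z 1 = 1 := by
  have h1 : 1 ∈ s.truncatedDivisors z := mem_truncatedDivisors.2 ⟨one_dvd _, hz⟩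
  have hG := (selbergSum_pos (s := s) hz).ne'
  rw [selbergWeights, if_pos h1]
  simp only [one_dvd, filter_true, s.nu_mult.map_one]
  rw [← selbergSum]
  simp [hG]

/-- The sum over multiples of d is part of the full Selberg sum, so their ratio is at most 1. This
bound is weak but suffices, since the level will be a small power of x. -/
theorem abs_selbergWeights_le (hz : 1 ≤ z) {d : ℕ} (hd : d ∈ s.truncatedDivisors z) :
    |s.selbergWeights z d| ≤ (s.nu d)⁻¹ := by
  have hG := selbergSum_pos (s := s) hz
  have hν := nu_pos_of_dvd_prodPrimes (mem_truncatedDivisors.1 hd).1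
  have h0 : 0 ≤ ∑ l ∈ s.truncatedDivisors z with d ∣ l, s.selbergTerms l :=
    sum_nonneg fun l hl => (selbergTerms_pos_of_mem (mem_filter.1 hl).1).le
  have h1 : ∑ l ∈ s.truncatedDivisors z with d ∣ l, s.selbergTerms l ≤ s.selbergSum z :=
    sum_le_sum_of_subset_of_nonneg (filter_subset _ _)
      fun l hl _ => (selbergTerms_pos_of_mem hl).le
  have hμ : |(μ d : ℝ)| ≤ 1 := by exact_mod_cast abs_moebius_le_one
  rw [selbergWeights, if_pos hd, abs_mul, abs_mul, abs_mul, abs_of_nonneg h0,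
    abs_of_pos (inv_pos.2 hG), abs_of_pos (inv_pos.2 hν)]
  calc _ ≤ 1 * (s.nu d)⁻¹ * (s.selbergSum z)⁻¹ * s.selbergSum z := by gcongr
    _ = _ := by field_simp

/-- With d = l e and m = l k, squarefreeness gives μ(l e) = μ(l) μ(e), and the sum of μ(e) over e ∣
k vanishes unless k = 1. -/
theorem sum_moebius_of_dvd_of_dvd {l m P : ℕ} (hP : Squarefree P) (hl : l ∣ P) (hm : m ∣ P) :
    ∑ d ∈ P.divisors with l ∣ d ∧ d ∣ m, (μ d : ℝ) = if l = m then (μ l : ℝ) else 0 := by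
  by_cases hlm : l ∣ m
  · obtain ⟨k, rfl⟩ := hlm
    have hsq := hP.squarefree_of_dvd hm
    have hl0 : l ≠ 0 := by rintro rfl; simp at hsq
    have hk0 : k ≠ 0 := by rintro rfl; simp at hsq
    have hset : P.divisors.filter (fun d => l ∣ d ∧ d ∣ l * k) = k.divisors.image (l * ·) := by
      ext d
      simp only [mem_filter, Nat.mem_divisors, mem_image]
      constructor
      · rintro ⟨-, ⟨e, rfl⟩, h⟩
        exact ⟨e, ⟨(Nat.mul_dvd_mul_iff_left (Nat.pos_of_ne_zero hl0)).1 h, hk0⟩, rfl⟩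
      · rintro ⟨e, ⟨he, -⟩, rfl⟩
        have : l * e ∣ l * k := Nat.mul_dvd_mul_left l he
        exact ⟨⟨this.trans hm, hP.ne_zero⟩, dvd_mul_right _ _, this⟩
    rw [hset, sum_image (fun a _ b _ h => Nat.eq_of_mul_eq_mul_left (Nat.pos_of_ne_zero hl0) h)]
    have : ∀ e ∈ k.divisors, (μ (l * e) : ℝ) = μ l * μ e := by
      intro e he
      have : Nat.Coprime l e := Nat.Coprime.coprime_dvd_right (Nat.mem_divisors.1 he).1
        (Nat.squarefree_mul_iff.1 hsq).1
      rw [isMultiplicative_moebius.map_mul_of_coprime this]; push_cast; ring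
    rw [sum_congr rfl this, ← mul_sum]
    have h2 : ∑ e ∈ k.divisors, (μ e : ℝ) = if k = 1 then 1 else 0 := by
      have h3 := congrArg (fun f => f k) moebius_mul_coe_zeta
      simp only [one_apply, coe_mul_zeta_apply] at h3
      exact_mod_cast h3
    rw [h2]
    have : l = l * k ↔ k = 1 := by
      constructor
      · intro h; exact Nat.eq_of_mul_eq_mul_left (Nat.pos_of_ne_zero hl0) (by omega)
      · rintro rfl; simp
    simp [this]
  · rw [if_neg (by rintro rfl; exact hlm dvd_rfl), filter_false_of_mem, sum_empty]
    rintro d - ⟨h1, h2⟩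
    exact hlm (h1.trans h2)

/-- These sums are the coordinates in which the quadratic form of the sieve is diagonal. The weights
are the Möbius inverse of the optimal values of the coordinates, so inserting them and exchanging
sums recovers those values. -/
theorem sum_nu_mul_selbergWeights (l : ℕ) (hl : l ∣ s.prodPrimes) :
    (∑ d ∈ divisors s.prodPrimes, if l ∣ d then s.nu d * s.selbergWeights z d else 0) =
      if l ≤ z then (μ l : ℝ) * s.selbergTerms l * (s.selbergSum z)⁻¹ else 0 := by
  have h1 : ∀ d ∈ divisors s.prodPrimes,
      (if l ∣ d then s.nu d * s.selbergWeights z d else 0) =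
      ∑ m ∈ s.truncatedDivisors z, if l ∣ d ∧ d ∣ m then
        (μ d : ℝ) * (s.selbergTerms m * (s.selbergSum z)⁻¹) else 0 := by
    intro d hd
    by_cases hld : l ∣ d
    · simp only [hld, if_true, true_and]
      rw [← sum_filter]
      have hν := nu_ne_zero (Nat.mem_divisors.1 hd).1
      by_cases hdz : d ≤ z
      · rw [selbergWeights, if_pos (mem_truncatedDivisors.2 ⟨(Nat.mem_divisors.1 hd).1, hdz⟩),
          ← mul_sum, ← sum_mul]
        field_simp
      · rw [selbergWeights, if_neg (fun h => hdz (mem_truncatedDivisors.1 h).2),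
          filter_false_of_mem, sum_empty, mul_zero]
        intro m hm hdm
        have hm' := mem_truncatedDivisors.1 hm
        exact hdz ((Nat.le_of_dvd (Nat.pos_of_ne_zero
          (ne_zero_of_dvd_ne_zero prodPrimes_ne_zero hm'.1)) hdm).trans hm'.2)
    · simp [hld]
  rw [sum_congr rfl h1, sum_comm]
  have h2 : ∀ m ∈ s.truncatedDivisors z, (∑ d ∈ divisors s.prodPrimes, if l ∣ d ∧ d ∣ m then
        (μ d : ℝ) * (s.selbergTerms m * (s.selbergSum z)⁻¹) else 0) =
      if l = m then (μ l : ℝ) * (s.selbergTerms m * (s.selbergSum z)⁻¹) else 0 := by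
    intro m hm
    rw [← sum_filter, ← sum_mul,
      sum_moebius_of_dvd_of_dvd s.prodPrimes_squarefree hl (mem_truncatedDivisors.1 hm).1]
    split_ifs <;> simp
  rw [sum_congr rfl h2, sum_ite_eq]
  simp only [mem_truncatedDivisors, hl, true_and]
  split_ifs <;> ring

/-- With g the Selberg terms and G their sum, the coordinates are μ(l) g(l) / G, and the diagonal
form becomes ∑ g(l) / G² = 1 / G. -/
theorem mainSum_selbergWeights (hz : 1 ≤ z) :
    s.mainSum (lambdaSquared (s.selbergWeights z)) = (s.selbergSum z)⁻¹ := by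
  have hG := (selbergSum_pos (s := s) hz).ne'
  rw [mainSum_lambdaSquared_eq_sum_mul_sum_sq]
  have : ∀ l ∈ divisors s.prodPrimes, (s.selbergTerms l)⁻¹ *
        (∑ d ∈ divisors s.prodPrimes, if l ∣ d then s.nu d * s.selbergWeights z d else 0) ^ 2 =
      if l ≤ z then s.selbergTerms l * ((s.selbergSum z)⁻¹) ^ 2 else 0 := by
    intro l hl
    have hl' := (Nat.mem_divisors.1 hl).1
    rw [sum_nu_mul_selbergWeights l hl']
    have hg := (selbergTerms_pos hl').ne'
    have hμ : (μ l : ℝ) ^ 2 = 1 := by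
      exact_mod_cast moebius_sq_eq_one_of_squarefree
        (s.prodPrimes_squarefree.squarefree_of_dvd hl')
    split_ifs
    · rw [mul_pow, mul_pow, hμ]; field_simp
    · simp
  rw [sum_congr rfl this, ← sum_filter, ← sum_mul]
  change s.selbergSum z * _ = _
  field_simp

theorem errSum_lambdaSquared_le (w : ℕ → ℝ) :
    s.errSum (lambdaSquared w) ≤ ∑ d₁ ∈ divisors s.prodPrimes, ∑ d₂ ∈ divisors s.prodPrimes,
      |w d₁| * |w d₂| * |s.rem (d₁.lcm d₂)| := by
  have h1 : ∀ d ∈ divisors s.prodPrimes, |lambdaSquared w d| * |s.rem d| ≤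
      ∑ d₁ ∈ divisors s.prodPrimes, ∑ d₂ ∈ divisors s.prodPrimes,
        if d = d₁.lcm d₂ then |w d₁| * |w d₂| * |s.rem d| else 0 := by
    intro d hd
    have hsub : d.divisors ⊆ divisors s.prodPrimes :=
      Nat.divisors_subset_of_dvd prodPrimes_ne_zero (Nat.mem_divisors.1 hd).1
    have h2 : |lambdaSquared w d| ≤ ∑ d₁ ∈ divisors s.prodPrimes, ∑ d₂ ∈ divisors s.prodPrimes,
        if d = d₁.lcm d₂ then |w d₁| * |w d₂| else 0 := by
      have hnn : ∀ d₁ d₂ : ℕ, 0 ≤ if d = d₁.lcm d₂ then |w d₁| * |w d₂| else 0 := by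
        intro d₁ d₂; split_ifs <;> positivity
      calc |lambdaSquared w d|
          ≤ ∑ d₁ ∈ d.divisors, ∑ d₂ ∈ d.divisors,
              if d = d₁.lcm d₂ then |w d₁| * |w d₂| else 0 := by
            refine (abs_sum_le_sum_abs _ _).trans (sum_le_sum fun d₁ _ =>
              (abs_sum_le_sum_abs _ _).trans (sum_le_sum fun d₂ _ => ?_))
            split_ifs <;> simp [abs_mul]
        _ ≤ ∑ d₁ ∈ d.divisors, ∑ d₂ ∈ divisors s.prodPrimes,
              if d = d₁.lcm d₂ then |w d₁| * |w d₂| else 0 :=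
            sum_le_sum fun d₁ _ => sum_le_sum_of_subset_of_nonneg hsub fun _ _ _ => hnn _ _
        _ ≤ _ := sum_le_sum_of_subset_of_nonneg hsub fun _ _ _ => sum_nonneg fun _ _ => hnn _ _
    refine (mul_le_mul_of_nonneg_right h2 (abs_nonneg _)).trans (le_of_eq ?_)
    simp_rw [sum_mul, ite_mul, zero_mul]
  refine (sum_le_sum h1).trans (le_of_eq ?_)
  rw [sum_comm]
  refine sum_congr rfl fun d₁ h₁ => ?_
  rw [sum_comm]
  refine sum_congr rfl fun d₂ h₂ => ?_
  have hmem : d₁.lcm d₂ ∈ divisors s.prodPrimes := Nat.mem_divisors.2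
    ⟨Nat.lcm_dvd (Nat.mem_divisors.1 h₁).1 (Nat.mem_divisors.1 h₂).1, prodPrimes_ne_zero⟩
  rw [sum_ite_eq_of_mem' _ _ _ hmem]

/-- The Selberg sieve with a crude estimate of the remainder. -/
theorem siftedSum_le_div_selbergSum (hz : 1 ≤ z)
    (hν : ∀ d, d ∣ s.prodPrimes → 1 ≤ d * s.nu d)
    (hrem : ∀ d, d ∣ s.prodPrimes → |s.rem d| ≤ d * s.nu d) :
    s.siftedSum ≤ s.totalMass / s.selbergSum z + (z : ℝ) ^ 4 := by
  have hmain := siftedSum_le_mainSum_errSum_of_upperMoebius (s := s) _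
    (upperMoebius_lambdaSquared (s.selbergWeights z) (selbergWeights_one hz))
  rw [mainSum_selbergWeights hz] at hmain
  refine hmain.trans ?_
  rw [div_eq_mul_inv]
  gcongr
  refine (errSum_lambdaSquared_le _).trans ?_
  have h1 : ∀ d₁ ∈ divisors s.prodPrimes, ∀ d₂ ∈ divisors s.prodPrimes,
      |s.selbergWeights z d₁| * |s.selbergWeights z d₂| * |s.rem (d₁.lcm d₂)| ≤
        (if d₁ ≤ z then (d₁ : ℝ) else 0) * (if d₂ ≤ z then (d₂ : ℝ) else 0) := by
    intro d₁ h₁ d₂ h₂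
    have h₁' := (Nat.mem_divisors.1 h₁).1
    have h₂' := (Nat.mem_divisors.1 h₂).1
    by_cases hz₁ : d₁ ≤ z
    · by_cases hz₂ : d₂ ≤ z
      · have hn₁ := nu_pos_of_dvd_prodPrimes h₁'
        have hn₂ := nu_pos_of_dvd_prodPrimes h₂'
        have hg := hν (d₁.gcd d₂) ((Nat.gcd_dvd_left _ _).trans h₁')
        have hl := hν (d₁.lcm d₂) (Nat.lcm_dvd h₁' h₂')
        have hgn : s.nu (d₁.gcd d₂) ≠ 0 := nu_ne_zero ((Nat.gcd_dvd_left _ _).trans h₁')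
        have hlcm := s.nu_mult.map_lcm (x := d₁) (y := d₂) hgn
        have e1 : s.nu (d₁.lcm d₂) * s.nu (d₁.gcd d₂) = s.nu d₁ * s.nu d₂ := by
          rw [hlcm]; field_simp
        have e2 : ((d₁.gcd d₂ : ℕ) : ℝ) * (d₁.lcm d₂ : ℕ) = d₁ * d₂ := by
          exact_mod_cast Nat.gcd_mul_lcm d₁ d₂
        -- Multiplying by gcd · ν(gcd) ≥ 1 makes the bound for the lcm factor over d₁ and d₂. The
        -- factors ν(d₁) ν(d₂) then cancel against the bounds for the weights.
        have hR : |s.rem (d₁.lcm d₂)| ≤ (d₁ * s.nu d₁) * (d₂ * s.nu d₂) := by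
          refine (hrem _ (Nat.lcm_dvd h₁' h₂')).trans ?_
          calc ((d₁.lcm d₂ : ℕ) : ℝ) * s.nu (d₁.lcm d₂)
              ≤ ((d₁.lcm d₂ : ℕ) : ℝ) * s.nu (d₁.lcm d₂) *
                (((d₁.gcd d₂ : ℕ) : ℝ) * s.nu (d₁.gcd d₂)) :=
                le_mul_of_one_le_right (by linarith) hg
            _ = (((d₁.gcd d₂ : ℕ) : ℝ) * (d₁.lcm d₂ : ℕ)) *
                (s.nu (d₁.lcm d₂) * s.nu (d₁.gcd d₂)) := by ring
            _ = _ := by rw [e1, e2]; ring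
        rw [if_pos hz₁, if_pos hz₂]
        calc _ ≤ (s.nu d₁)⁻¹ * (s.nu d₂)⁻¹ * ((d₁ * s.nu d₁) * (d₂ * s.nu d₂)) := by
              gcongr
              · exact abs_selbergWeights_le hz (mem_truncatedDivisors.2 ⟨h₁', hz₁⟩)
              · exact abs_selbergWeights_le hz (mem_truncatedDivisors.2 ⟨h₂', hz₂⟩)
          _ = d₁ * d₂ := by field_simp
      · have : s.selbergWeights z d₂ = 0 :=
          if_neg fun h => hz₂ (mem_truncatedDivisors.1 h).2
        simp [this, hz₂]
    · have : s.selbergWeights z d₁ = 0 :=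
        if_neg fun h => hz₁ (mem_truncatedDivisors.1 h).2
      simp [this, hz₁]
  refine (sum_le_sum fun d₁ h₁ => sum_le_sum fun d₂ h₂ => h1 d₁ h₁ d₂ h₂).trans ?_
  rw [← sum_mul_sum]
  have h2 : ∑ d ∈ divisors s.prodPrimes, (if d ≤ z then (d : ℝ) else 0) ≤ (z : ℝ) ^ 2 := by
    rw [← sum_filter]
    calc ∑ d ∈ divisors s.prodPrimes with d ≤ z, (d : ℝ)
        ≤ ∑ d ∈ divisors s.prodPrimes with d ≤ z, (z : ℝ) :=
          sum_le_sum fun d hd => by exact_mod_cast (mem_filter.1 hd).2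
      _ ≤ ∑ d ∈ Icc 1 z, (z : ℝ) := by
          refine sum_le_sum_of_subset_of_nonneg ?_ fun _ _ _ => by positivity
          intro d hd
          have := mem_filter.1 hd
          exact mem_Icc.2 ⟨Nat.pos_of_mem_divisors this.1, this.2⟩
      _ = (z : ℝ) ^ 2 := by simp [sq]
  have h3 : 0 ≤ ∑ d ∈ divisors s.prodPrimes, (if d ≤ z then (d : ℝ) else 0) :=
    sum_nonneg fun d _ => by split_ifs <;> positivity
  calc _ ≤ (z : ℝ) ^ 2 * (z : ℝ) ^ 2 := mul_le_mul h2 h2 h3 (by positivity)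
    _ = _ := by ring

end BoundingSieve

/-! ### Roots of x (x + h) modulo squarefree numbers. -/

namespace Romanoff

open Finset

/-- The number of solutions of `x (x + h) = 0` in `ZMod d`. -/
noncomputable def shiftRootCount (h d : ℕ) : ℕ :=
  Nat.card {x : ZMod d // x * (x + (h : ZMod d)) = 0}

/-- The number of solutions of `x (x + h) = 0` modulo a prime `p`. -/
def localRootCount (h p : ℕ) : ℕ := if p ∣ h then 1 else 2

theorem shiftRootCount_mul {h m n : ℕ} (hmn : m.Coprime n) :
    shiftRootCount h (m * n) = shiftRootCount h m * shiftRootCount h n := by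
  rw [shiftRootCount, shiftRootCount, shiftRootCount, ← Nat.card_prod]
  let e := ZMod.chineseRemainder hmn
  refine Nat.card_congr ((e.toEquiv.subtypeEquiv
    (q := fun y : ZMod m × ZMod n => y.1 * (y.1 + h) = 0 ∧ y.2 * (y.2 + h) = 0) ?_).trans
    (Equiv.subtypeProdEquivProd (p := fun a : ZMod m => a * (a + h) = 0)
      (q := fun b : ZMod n => b * (b + h) = 0)))
  intro x
  rw [← map_eq_zero_iff e e.injective, map_mul, map_add, map_natCast, Prod.ext_iff]
  rfl

theorem shiftRootCount_prime {h p : ℕ} (hp : p.Prime) :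
    shiftRootCount h p = localRootCount h p := by
  have : Fact p.Prime := ⟨hp⟩
  rw [shiftRootCount, localRootCount]
  have hset : {x : ZMod p | x * (x + (h : ZMod p)) = 0} = {0, -(h : ZMod p)} := by
    ext x
    simp [add_eq_zero_iff_eq_neg]
  change Nat.card ↥{x : ZMod p | x * (x + (h : ZMod p)) = 0} = _
  rw [hset, Nat.card_coe_set_eq]
  split_ifs with hph
  · have : (h : ZMod p) = 0 := (ZMod.natCast_eq_zero_iff h p).2 hph
    simp [this]
  · have : (h : ZMod p) ≠ 0 := fun h0 => hph ((ZMod.natCast_eq_zero_iff h p).1 h0)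
    exact Set.ncard_pair (by simpa [eq_comm] using this)

theorem shiftRootCount_squarefree {h d : ℕ} (hd : Squarefree d) :
    shiftRootCount h d = ∏ p ∈ d.primeFactors, localRootCount h p := by
  induction d using Nat.recOnPosPrimePosCoprime with
  | prime_pow p n hp hn =>
    have : n = 1 := by
      by_contra hne
      have h2 : p * p ∣ p ^ n := by rw [← sq]; exact pow_dvd_pow p (by omega)
      exact hp.one_lt.ne' (Nat.isUnit_iff.1 (hd p h2))
    subst this
    rw [pow_one, shiftRootCount_prime hp, hp.primeFactors, prod_singleton]
  | zero => simp at hd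
  | one =>
    rw [shiftRootCount]
    simp only [Nat.primeFactors_one, prod_empty]
    have : Subsingleton (ZMod 1) := inferInstanceAs (Subsingleton (Fin 1))
    rw [Nat.card_eq_one_iff_unique]
    exact ⟨inferInstance, ⟨⟨0, by simp⟩⟩⟩
  | coprime a b ha hb hab iha ihb =>
    rw [shiftRootCount_mul hab, hab.primeFactors_mul, prod_union hab.disjoint_primeFactors,
      iha (hd.squarefree_of_dvd (dvd_mul_right _ _)),
      ihb (hd.squarefree_of_dvd (dvd_mul_left _ _))]

theorem abs_card_modEq_sub_le (M v : ℕ) {d : ℕ} (hd : 0 < d) :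
    |(((range M).filter (· ≡ v [MOD d])).card : ℝ) - (M : ℝ) / d| ≤ 1 := by
  rw [← Nat.count_eq_card_filter_range, Nat.count_modEq_card _ hd]
  have h1 : (M : ℝ) / d = (M / d : ℕ) + ((M % d : ℕ) : ℝ) / d := by
    have : (M : ℝ) = d * (M / d : ℕ) + (M % d : ℕ) := by exact_mod_cast (Nat.div_add_mod M d).symm
    have hd' : (d : ℝ) ≠ 0 := by positivity
    field_simp
    linarith
  have h2 : ((M % d : ℕ) : ℝ) / d ≤ 1 :=
    div_le_one_of_le₀ (by exact_mod_cast (Nat.mod_lt M hd).le) (by positivity)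
  have h3 : 0 ≤ ((M % d : ℕ) : ℝ) / d := by positivity
  rw [h1, abs_le]
  split_ifs <;> push_cast <;> constructor <;> linarith

/-- The condition on n selects one residue class modulo d for each root, and each class costs an
error of at most 1. -/
theorem abs_card_dvd_mul_add_sub_le (h M : ℕ) {d : ℕ} (hd : 0 < d) :
    |(((range M).filter (fun n => d ∣ n * (n + h))).card : ℝ) -
      (shiftRootCount h d : ℝ) * ((M : ℝ) / d)| ≤ shiftRootCount h d := by
  have : NeZero d := ⟨hd.ne'⟩
  classical
  set R : Finset (ZMod d) := univ.filter fun x => x * (x + (h : ZMod d)) = 0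
  have hR : shiftRootCount h d = R.card := by
    rw [shiftRootCount, Nat.card_eq_fintype_card, Fintype.card_subtype]
  have hmem : ∀ n : ℕ, d ∣ n * (n + h) ↔ (n : ZMod d) ∈ R := by
    intro n
    rw [← ZMod.natCast_eq_zero_iff]
    simp [R]
  have hcard : ((range M).filter (fun n => d ∣ n * (n + h))).card =
      ∑ x ∈ R, ((range M).filter (· ≡ x.val [MOD d])).card := by
    rw [card_eq_sum_card_fiberwise (f := fun n : ℕ => (n : ZMod d)) (t := R)]
    · refine sum_congr rfl fun x hx => congrArg _ ?_
      ext n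
      rw [mem_filter, mem_filter, mem_filter, ← ZMod.natCast_eq_natCast_iff, ZMod.natCast_zmod_val,
        hmem]
      constructor
      · rintro ⟨⟨h1, -⟩, h2⟩; exact ⟨h1, h2⟩
      · rintro ⟨h1, h2⟩; exact ⟨⟨h1, h2 ▸ hx⟩, h2⟩
    · intro n hn
      exact (hmem n).1 (mem_filter.1 hn).2
  rw [hcard, hR]
  push_cast
  rw [← nsmul_eq_mul, ← sum_const, ← sum_sub_distrib]
  refine (abs_sum_le_sum_abs _ _).trans ?_
  refine (sum_le_sum fun x _ => abs_card_modEq_sub_le M x.val hd).trans ?_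
  simp

end Romanoff

/-! ### A lower bound for the Selberg sum in terms of the singular factor. -/

namespace Romanoff

open Finset

/-- The singular factor `∏_{p ∣ h} (1 + 1 / p)`. -/
noncomputable def singularFactor (h : ℕ) : ℝ := ∏ p ∈ h.primeFactors, (1 + (p : ℝ)⁻¹)

theorem one_le_singularFactor (h : ℕ) : 1 ≤ singularFactor h :=
  prod_induction _ (1 ≤ ·) (fun _ _ => one_le_mul_of_one_le_of_one_le) le_rfl fun p _ => by simp

theorem sum_le_sum_of_injOn {ι κ : Type*} {I : Finset ι} {J : Finset κ} {f : ι → ℝ} {g : κ → ℝ}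
    (φ : ι → κ) (hmap : ∀ i ∈ I, φ i ∈ J) (hinj : Set.InjOn φ I) (hfg : ∀ i ∈ I, f i ≤ g (φ i))
    (hg : ∀ j ∈ J, 0 ≤ g j) : ∑ i ∈ I, f i ≤ ∑ j ∈ J, g j := by
  classical
  calc ∑ i ∈ I, f i ≤ ∑ i ∈ I, g (φ i) := sum_le_sum hfg
    _ = ∑ j ∈ I.image φ, g j := (sum_image hinj).symm
    _ ≤ ∑ j ∈ J, g j := sum_le_sum_of_subset_of_nonneg (image_subset_iff.2 hmap)
        fun j hj _ => hg j hj

theorem sum_Icc_inv_sq_le_two (y : ℕ) : ∑ m ∈ Icc 1 y, ((m : ℝ) ^ 2)⁻¹ ≤ 2 := by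
  have h := sum_Ioo_inv_sq_le (α := ℝ) 0 (y + 1)
  have : Ioo 0 (y + 1) = Icc 1 y := by ext; simp; omega
  rw [this] at h
  simpa using h

theorem sum_divisors_inv {n : ℕ} (hn : Squarefree n) :
    ∑ d ∈ n.divisors, (d : ℝ)⁻¹ = singularFactor n := by
  let f : ArithmeticFunction ℝ := ⟨fun n => (n : ℝ)⁻¹, by simp⟩
  have hf : f.IsMultiplicative := by
    refine ⟨by simp [f], fun {m n} _ => ?_⟩
    change ((m * n : ℕ) : ℝ)⁻¹ = (m : ℝ)⁻¹ * (n : ℝ)⁻¹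
    push_cast; rw [mul_inv]
  exact (hf.prodPrimeFactors_one_add_of_squarefree hn).symm

/-- A prime of d that does not divide h may be used or not, a prime dividing h may not be used.
Reading the root count as a number of divisors lets sums over d unfold into sums over pairs. -/
theorem card_divisors_coprime (h : ℕ) {d : ℕ} (hd : Squarefree d) :
    (d.divisors.filter (·.Coprime h)).card = ∏ p ∈ d.primeFactors, localRootCount h p := by
  let f : ArithmeticFunction ℕ := ⟨fun n => if n ≠ 0 ∧ n.Coprime h then 1 else 0, by simp⟩
  have hf : f.IsMultiplicative := by
    refine ⟨by simp [f], fun {m n} _ => ?_⟩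
    change (if m * n ≠ 0 ∧ (m * n).Coprime h then 1 else 0) =
      (if m ≠ 0 ∧ m.Coprime h then 1 else 0) * (if n ≠ 0 ∧ n.Coprime h then 1 else 0)
    simp only [Nat.coprime_mul_iff_left, mul_ne_zero_iff]
    split_ifs <;> first | rfl | tauto
  have key := hf.prodPrimeFactors_one_add_of_squarefree hd
  rw [card_filter]
  calc _ = ∑ i ∈ d.divisors, f i := by
        refine sum_congr rfl fun i hi => ?_
        have : i ≠ 0 := (Nat.pos_of_mem_divisors hi).ne'
        simp [f, this]
    _ = _ := by
        rw [← key]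
        refine prod_congr rfl fun p hp => ?_
        have hp' := Nat.prime_of_mem_primeFactors hp
        change 1 + (if p ≠ 0 ∧ p.Coprime h then 1 else 0) = _
        rw [localRootCount]
        by_cases hph : p ∣ h
        · simp [hph, hp'.coprime_iff_not_dvd]
        · simp [hph, hp'.coprime_iff_not_dvd, hp'.ne_zero]

/-- Each n is m² s with s squarefree, and the sum of 1 / m² is at most 2. -/
theorem sum_inv_le_two_mul_sum_squarefree (y : ℕ) :
    ∑ n ∈ Icc 1 y, (n : ℝ)⁻¹ ≤ 2 * ∑ s ∈ Icc 1 y with Squarefree s, (s : ℝ)⁻¹ := by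
  have hex : ∀ n : ℕ, ∃ q : ℕ × ℕ, q.1 ^ 2 * q.2 = n ∧ Squarefree q.2 := fun n => by
    obtain ⟨a, b, h1, h2⟩ := Nat.sq_mul_squarefree n
    exact ⟨(b, a), h1, h2⟩
  choose φ hφ hsq using hex
  calc ∑ n ∈ Icc 1 y, (n : ℝ)⁻¹
      ≤ ∑ q ∈ Icc 1 y ×ˢ (Icc 1 y).filter Squarefree, ((q.1 : ℝ) ^ 2)⁻¹ * (q.2 : ℝ)⁻¹ := by
        refine sum_le_sum_of_injOn φ (fun n hn => ?_) (fun a _ b _ hab => ?_) (fun n _ => ?_)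
          fun _ _ => by positivity
        · have hn' := mem_Icc.1 hn
          have h1 := hφ n
          have hm : (φ n).1 ≠ 0 := by intro h0; rw [h0] at h1; simp at h1; omega
          have hs : (φ n).2 ≠ 0 := (hsq n).ne_zero
          have hm1 : (φ n).1 ≤ n := by
            calc (φ n).1 ≤ (φ n).1 ^ 2 := Nat.le_self_pow two_ne_zero _
              _ ≤ (φ n).1 ^ 2 * (φ n).2 := Nat.le_mul_of_pos_right _ (Nat.pos_of_ne_zero hs)
              _ = n := h1
          have hs1 : (φ n).2 ≤ n := by
            calc (φ n).2 ≤ (φ n).1 ^ 2 * (φ n).2 :=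
                  Nat.le_mul_of_pos_left _ (by positivity)
              _ = n := h1
          simp only [mem_product, mem_filter, mem_Icc]
          exact ⟨⟨by omega, by omega⟩, ⟨by omega, by omega⟩, hsq n⟩
        · rw [← hφ a, ← hφ b, hab]
        · refine le_of_eq ?_
          rw [← mul_inv]
          congr 1
          exact_mod_cast (hφ n).symm
    _ = (∑ m ∈ Icc 1 y, ((m : ℝ) ^ 2)⁻¹) * ∑ s ∈ Icc 1 y with Squarefree s, (s : ℝ)⁻¹ := by
        rw [sum_product, sum_mul_sum]
    _ ≤ _ := by
        gcongr
        exact sum_Icc_inv_sq_le_two y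

/-- Dividing a pair by its gcd g leaves a coprime pair and a factor 1 / g², which again sums to at
most 2. -/
theorem sq_sum_squarefree_inv_le (y : ℕ) :
    (∑ s ∈ Icc 1 y with Squarefree s, (s : ℝ)⁻¹) ^ 2 ≤
      2 * ∑ q ∈ ((Icc 1 y).filter Squarefree ×ˢ (Icc 1 y).filter Squarefree).filter
        (fun q => q.1.Coprime q.2), (q.1 : ℝ)⁻¹ * (q.2 : ℝ)⁻¹ := by
  set S := (Icc 1 y).filter Squarefree
  set T := (S ×ˢ S).filter (fun q => q.1.Coprime q.2)
  have hdiv : ∀ s ∈ S, ∀ g, 0 < g → g ∣ s → s / g ∈ S := by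
    intro s hs g hg hgs
    have hs' := mem_filter.1 hs
    have h1 := mem_Icc.1 hs'.1
    exact mem_filter.2 ⟨mem_Icc.2 ⟨Nat.div_pos (Nat.le_of_dvd h1.1 hgs) hg,
      (Nat.div_le_self _ _).trans h1.2⟩, hs'.2.squarefree_of_dvd (Nat.div_dvd_of_dvd hgs)⟩
  calc (∑ s ∈ S, (s : ℝ)⁻¹) ^ 2 = ∑ q ∈ S ×ˢ S, (q.1 : ℝ)⁻¹ * (q.2 : ℝ)⁻¹ := by
        rw [sq, sum_mul_sum, sum_product]
    _ ≤ ∑ r ∈ Icc 1 y ×ˢ T, ((r.1 : ℝ) ^ 2)⁻¹ * ((r.2.1 : ℝ)⁻¹ * (r.2.2 : ℝ)⁻¹) := by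
        refine sum_le_sum_of_injOn
          (fun q => (q.1.gcd q.2, (q.1 / q.1.gcd q.2, q.2 / q.1.gcd q.2)))
          (fun q hq => ?_) (fun a ha b hb hab => ?_) (fun q hq => ?_) fun _ _ => by positivity
        · obtain ⟨h1, h2⟩ := mem_product.1 hq
          have h1' := mem_Icc.1 (mem_filter.1 h1).1
          have hg : 0 < q.1.gcd q.2 := Nat.gcd_pos_of_pos_left _ h1'.1
          refine mem_product.2 ⟨mem_Icc.2 ⟨hg, (Nat.gcd_le_left _ h1'.1).trans h1'.2⟩,
            mem_filter.2 ⟨mem_product.2 ⟨hdiv _ h1 _ hg (Nat.gcd_dvd_left _ _),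
              hdiv _ h2 _ hg (Nat.gcd_dvd_right _ _)⟩, Nat.coprime_div_gcd_div_gcd hg⟩⟩
        · simp only [Prod.mk.injEq] at hab
          obtain ⟨e1, e2, e3⟩ := hab
          refine Prod.ext ?_ ?_
          · rw [← Nat.div_mul_cancel (Nat.gcd_dvd_left a.1 a.2),
              ← Nat.div_mul_cancel (Nat.gcd_dvd_left b.1 b.2), e2, e1]
          · rw [← Nat.div_mul_cancel (Nat.gcd_dvd_right a.1 a.2),
              ← Nat.div_mul_cancel (Nat.gcd_dvd_right b.1 b.2), e3, e1]
        · refine le_of_eq ?_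
          have h1' := mem_Icc.1 (mem_filter.1 (mem_product.1 hq).1).1
          have hg : ((q.1.gcd q.2 : ℕ) : ℝ) ≠ 0 := by
            exact_mod_cast (Nat.gcd_pos_of_pos_left _ h1'.1).ne'
          have e1 : (q.1 : ℝ) = (q.1 / q.1.gcd q.2 : ℕ) * (q.1.gcd q.2 : ℕ) := by
            exact_mod_cast (Nat.div_mul_cancel (Nat.gcd_dvd_left q.1 q.2)).symm
          have e2 : (q.2 : ℝ) = (q.2 / q.1.gcd q.2 : ℕ) * (q.1.gcd q.2 : ℕ) := by
            exact_mod_cast (Nat.div_mul_cancel (Nat.gcd_dvd_right q.1 q.2)).symm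
          conv_lhs => rw [e1, e2]
          rw [← mul_inv, ← mul_inv, ← mul_inv]
          congr 1
          ring
    _ = (∑ m ∈ Icc 1 y, ((m : ℝ) ^ 2)⁻¹) * ∑ q ∈ T, (q.1 : ℝ)⁻¹ * (q.2 : ℝ)⁻¹ := by
        rw [sum_product, sum_mul_sum]
    _ ≤ _ := by
        gcongr
        exact sum_Icc_inv_sq_le_two y

/-- Split a coprime pair (s, t) by e = gcd(s, h) and s = e s'. The factor 1 / e is a term of the
expanded singular factor, and d = s' t ≤ y² is squarefree with the marked divisor s' coprime to h.
Since e, d and s' determine (s, t), the sum embeds into the product on the right. -/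
theorem sum_coprime_le_singularFactor_mul {h : ℕ} (hh : h ≠ 0) {y z : ℕ} (hyz : y ^ 2 ≤ z) :
    ∑ q ∈ ((Icc 1 y).filter Squarefree ×ˢ (Icc 1 y).filter Squarefree).filter
        (fun q => q.1.Coprime q.2), (q.1 : ℝ)⁻¹ * (q.2 : ℝ)⁻¹ ≤
      singularFactor h * ∑ d ∈ Icc 1 z with Squarefree d,
        ((∏ p ∈ d.primeFactors, localRootCount h p : ℕ) : ℝ) / d := by
  set S := (Icc 1 y).filter Squarefree
  set D := (Icc 1 z).filter Squarefree
  -- The radical of h has the same singular factor and is squarefree, so its divisor sum expands the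
  -- product.
  set r := ∏ p ∈ h.primeFactors, p
  have hrsq : Squarefree r := by
    refine (Finset.squarefree_prod_of_pairwise_isCoprime ?_ fun p hp =>
      (Nat.prime_of_mem_primeFactors hp).prime.squarefree)
    intro p hp q hq hpq
    exact Nat.coprime_iff_isRelPrime.1 ((Nat.coprime_primes (Nat.prime_of_mem_primeFactors hp)
      (Nat.prime_of_mem_primeFactors hq)).2 hpq)
  have hr : singularFactor h = ∑ e ∈ r.divisors, (e : ℝ)⁻¹ := by
    rw [sum_divisors_inv hrsq, singularFactor, singularFactor,
      Nat.primeFactors_prod fun p hp => Nat.prime_of_mem_primeFactors hp]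
  have hD : ∑ d ∈ D, ((∏ p ∈ d.primeFactors, localRootCount h p : ℕ) : ℝ) / d =
      ∑ t ∈ D.sigma fun d => d.divisors.filter (·.Coprime h), (t.1 : ℝ)⁻¹ := by
    rw [sum_sigma]
    refine sum_congr rfl fun d hd => ?_
    rw [← card_divisors_coprime h (mem_filter.1 hd).2, div_eq_mul_inv, ← nsmul_eq_mul]
    exact (sum_const _).symm
  rw [hr, hD, sum_mul_sum, ← sum_product']
  have hg : ∀ s ∈ S, s.gcd h * (s / s.gcd h) = s := fun s _ =>
    Nat.mul_div_cancel' (Nat.gcd_dvd_left s h)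
  have hpos : ∀ s ∈ S, 0 < s.gcd h ∧ 0 < s / s.gcd h := fun s hs => by
    have hs0 : 0 < s := (mem_Icc.1 (mem_filter.1 hs).1).1
    have := Nat.gcd_pos_of_pos_left h hs0
    exact ⟨this, Nat.div_pos (Nat.gcd_le_left _ hs0) this⟩
  refine sum_le_sum_of_injOn
    (fun q : ℕ × ℕ => (q.1.gcd h, ⟨q.1 / q.1.gcd h * q.2, q.1 / q.1.gcd h⟩))
    (fun q hq => ?_) (fun a ha b hb hab => ?_) (fun q hq => ?_) fun _ _ => by positivity
  · obtain ⟨hq1, hcop⟩ := mem_filter.1 hq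
    obtain ⟨h1, h2⟩ := mem_product.1 hq1
    obtain ⟨h1i, h1s⟩ := mem_filter.1 h1
    obtain ⟨h2i, h2s⟩ := mem_filter.1 h2
    have hp := hpos _ h1
    have hdv : q.1 / q.1.gcd h ∣ q.1 := Nat.div_dvd_of_dvd (Nat.gcd_dvd_left _ _)
    have hsq : Squarefree (q.1.gcd h * (q.1 / q.1.gcd h)) := (hg _ h1).symm ▸ h1s
    refine mem_product.2 ⟨Nat.mem_divisors.2 ⟨?_, hrsq.ne_zero⟩, mem_sigma.2
      ⟨mem_filter.2 ⟨mem_Icc.2 ⟨?_, ?_⟩, ?_⟩, mem_filter.2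
        ⟨Nat.mem_divisors.2 ⟨dvd_mul_right _ _, ?_⟩, ?_⟩⟩⟩
    · rw [← Nat.prod_primeFactors_of_squarefree
        (h1s.squarefree_of_dvd (Nat.gcd_dvd_left q.1 h))]
      exact prod_dvd_prod_of_subset _ _ _ (Nat.primeFactors_mono (Nat.gcd_dvd_right _ _) hh)
    · exact Nat.mul_pos hp.2 (mem_Icc.1 h2i).1
    · calc q.1 / q.1.gcd h * q.2 ≤ y * y :=
            Nat.mul_le_mul ((Nat.div_le_self _ _).trans (mem_Icc.1 h1i).2) (mem_Icc.1 h2i).2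
        _ = y ^ 2 := (sq y).symm
        _ ≤ z := hyz
    · exact (Nat.squarefree_mul_iff).2 ⟨hcop.coprime_dvd_left hdv, h1s.squarefree_of_dvd hdv, h2s⟩
    · exact (Nat.mul_pos hp.2 (mem_Icc.1 h2i).1).ne'
    -- A common divisor of h and s / gcd(s, h) also divides gcd(s, h), which is coprime to s /
    -- gcd(s, h) because s is squarefree.
    · refine Nat.Coprime.symm ?_
      have hc := (Nat.squarefree_mul_iff.1 hsq).1
      rw [Nat.coprime_iff_gcd_eq_one]
      refine Nat.dvd_one.1 ?_
      have : h.gcd (q.1 / q.1.gcd h) ∣ q.1.gcd h :=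
        Nat.dvd_gcd ((Nat.gcd_dvd_right _ _).trans hdv) (Nat.gcd_dvd_left _ _)
      rw [← Nat.coprime_iff_gcd_eq_one.1 hc]
      exact Nat.dvd_gcd this (Nat.gcd_dvd_right _ _)
  · have ha1 := (mem_product.1 (mem_filter.1 ha).1).1
    have hb1 := (mem_product.1 (mem_filter.1 hb).1).1
    simp only [Prod.mk.injEq, Sigma.mk.injEq, heq_eq_eq] at hab
    obtain ⟨e1, e2, e3⟩ := hab
    have h1 : a.1 = b.1 := by rw [← hg _ ha1, ← hg _ hb1, e3, e1]
    rw [e3] at e2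
    exact Prod.ext h1 (Nat.eq_of_mul_eq_mul_left (hpos _ hb1).2 e2)
  · have h1 := (mem_product.1 (mem_filter.1 hq).1).1
    refine le_of_eq ?_
    have e1 : (q.1 : ℝ) = (q.1.gcd h : ℕ) * (q.1 / q.1.gcd h : ℕ) := by
      exact_mod_cast (hg _ h1).symm
    conv_lhs => rw [e1]
    push_cast
    rw [mul_inv, mul_inv, mul_assoc]

/-- The square of the harmonic sum loses 2² in the passage to squarefree numbers and 2 in the
passage to coprime pairs, hence the 8. -/
theorem log_sq_le_singularFactor_mul {h : ℕ} (hh : h ≠ 0) {y z : ℕ} (hyz : y ^ 2 ≤ z) :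
    Real.log (y + 1) ^ 2 ≤ 8 * singularFactor h * ∑ d ∈ Icc 1 z with Squarefree d,
      ((∏ p ∈ d.primeFactors, localRootCount h p : ℕ) : ℝ) / d := by
  have h0 : Real.log (y + 1) ≤ ∑ n ∈ Icc 1 y, (n : ℝ)⁻¹ := by
    have := log_add_one_le_harmonic y
    rw [harmonic_eq_sum_Icc] at this
    push_cast at this
    exact this
  have h1 := h0.trans (sum_inv_le_two_mul_sum_squarefree y)
  have h2 := sq_sum_squarefree_inv_le y
  have h3 := sum_coprime_le_singularFactor_mul hh hyz
  have hl : 0 ≤ Real.log ((y : ℝ) + 1) := Real.log_nonneg (by simp)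
  have h4 := pow_le_pow_left₀ hl h1 2
  rw [mul_pow] at h4
  linarith

end Romanoff

/-! ### The sieve bound for prime pairs p, p + h. -/

namespace Romanoff

open Finset

theorem localRootCount_pos (h p : ℕ) : 0 < localRootCount h p := by
  rw [localRootCount]; split_ifs <;> norm_num

/-- Two roots could fill all classes only modulo 2, and then evenness of h merges them. This is why
the sieve is set up for even h only. -/
theorem localRootCount_lt {h p : ℕ} (h2 : 2 ∣ h) (hp : p.Prime) : localRootCount h p < p := by
  rw [localRootCount]
  split_ifs with hph
  · exact hp.one_lt
  · exact lt_of_le_of_ne hp.two_le fun e => hph (e ▸ h2)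

theorem squarefree_primorial (z : ℕ) : Squarefree (primorial z) := by
  rw [primorial]
  refine Finset.squarefree_prod_of_pairwise_isCoprime ?_ fun p hp =>
    (mem_filter.1 hp).2.prime.squarefree
  intro p hp q hq hpq
  exact Nat.coprime_iff_isRelPrime.1
    ((Nat.coprime_primes (mem_filter.1 hp).2 (mem_filter.1 hq).2).2 hpq)

theorem dvd_primorial_of_squarefree {d z : ℕ} (hd : Squarefree d) (hdz : d ≤ z) :
    d ∣ primorial z := by
  rw [← Nat.prod_primeFactors_of_squarefree hd, primorial]
  refine prod_dvd_prod_of_subset _ _ _ fun p hp => ?_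
  have := (Nat.le_of_mem_primeFactors hp).trans hdz
  exact mem_filter.2 ⟨mem_range.2 (by omega), Nat.prime_of_mem_primeFactors hp⟩

/-- The sieve problem for the values `n (n + h)` with `n < M`, where `h` is even and the primes
up to `z` are sifted out. -/
noncomputable def shiftSieve (h M z : ℕ) (h2 : 2 ∣ h) : BoundingSieve where
  -- The map is injective (`strictMono_mul_add`), so sums over the image are sums over n and unit
  -- weights suffice.
  support := (range M).image fun n => n * (n + h)
  prodPrimes := primorial z
  prodPrimes_squarefree := squarefree_primorial z
  weights := fun _ => 1
  weights_nonneg := fun _ => zero_le_one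
  totalMass := M
  nu := ArithmeticFunction.prodPrimeFactors fun p => (localRootCount h p : ℝ) / p
  nu_mult := ArithmeticFunction.IsMultiplicative.prodPrimeFactors _
  nu_pos_of_prime := fun p hp _ => by
    rw [ArithmeticFunction.prodPrimeFactors_apply hp.ne_zero, hp.primeFactors, prod_singleton]
    have := localRootCount_pos h p
    have := hp.pos
    positivity
  nu_lt_one_of_prime := fun p hp _ => by
    rw [ArithmeticFunction.prodPrimeFactors_apply hp.ne_zero, hp.primeFactors, prod_singleton]
    have := hp.pos
    rw [div_lt_one (by positivity)]
    exact_mod_cast localRootCount_lt h2 hp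

theorem strictMono_mul_add (h : ℕ) : StrictMono fun n : ℕ => n * (n + h) := by
  intro a b hab
  exact Nat.mul_lt_mul'' hab (by omega)

theorem shiftSieve_nu {h M z : ℕ} (h2 : 2 ∣ h) {d : ℕ} (hd : Squarefree d) :
    (shiftSieve h M z h2).nu d = ((∏ p ∈ d.primeFactors, localRootCount h p : ℕ) : ℝ) / d := by
  change ArithmeticFunction.prodPrimeFactors (fun p => (localRootCount h p : ℝ) / p) d = _
  rw [ArithmeticFunction.prodPrimeFactors_apply hd.ne_zero, prod_div_distrib]
  push_cast
  congr 1
  rw [← Nat.cast_prod, Nat.prod_primeFactors_of_squarefree hd]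

theorem shiftSieve_rem {h M z : ℕ} (h2 : 2 ∣ h) {d : ℕ} (hd : Squarefree d) :
    |(shiftSieve h M z h2).rem d| ≤ d * (shiftSieve h M z h2).nu d := by
  have hd0 : 0 < d := Nat.pos_of_ne_zero hd.ne_zero
  have hdR : (d : ℝ) ≠ 0 := by positivity
  have key := abs_card_dvd_mul_add_sub_le h M hd0
  rw [shiftRootCount_squarefree hd] at key
  have hms : (shiftSieve h M z h2).multSum d =
      (((range M).filter (fun n => d ∣ n * (n + h))).card : ℝ) := by
    change ∑ n ∈ (range M).image (fun n => n * (n + h)), (if d ∣ n then (1 : ℝ) else 0) = _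
    rw [sum_image ((strictMono_mul_add h).injective.injOn), ← sum_filter, sum_const, nsmul_eq_mul,
      mul_one]
  rw [BoundingSieve.rem, hms, shiftSieve_nu h2 hd]
  change |_ - _ * (M : ℝ)| ≤ _
  rw [mul_div_cancel₀ _ hdR]
  convert key using 2
  ring

/-- The Selberg term at d is ν(d) times factors 1 / (1 - ν(p)) ≥ 1, and every squarefree d ≤ z
divides the primorial. -/
theorem sum_le_selbergSum_shiftSieve {h M z : ℕ} (h2 : 2 ∣ h) :
    ∑ d ∈ Icc 1 z with Squarefree d, ((∏ p ∈ d.primeFactors, localRootCount h p : ℕ) : ℝ) / d ≤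
      (shiftSieve h M z h2).selbergSum z := by
  refine sum_le_sum_of_injOn id (fun d hd => ?_) (Set.injOn_id _) (fun d hd => ?_)
    fun d hd => (BoundingSieve.selbergTerms_pos_of_mem hd).le
  · obtain ⟨h1, h3⟩ := mem_filter.1 hd
    exact BoundingSieve.mem_truncatedDivisors.2
      ⟨dvd_primorial_of_squarefree h3 (mem_Icc.1 h1).2, (mem_Icc.1 h1).2⟩
  · obtain ⟨h1, h3⟩ := mem_filter.1 hd
    have hdv : d ∣ (shiftSieve h M z h2).prodPrimes :=
      dvd_primorial_of_squarefree h3 (mem_Icc.1 h1).2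
    rw [← shiftSieve_nu (M := M) (z := z) h2 h3, id, BoundingSieve.selbergTerms_apply]
    refine le_mul_of_one_le_right (BoundingSieve.nu_pos_of_dvd_prodPrimes hdv).le ?_
    refine prod_induction _ (1 ≤ ·) (fun _ _ => one_le_mul_of_one_le_of_one_le) le_rfl
      fun p hp => ?_
    have hp' := Nat.prime_of_mem_primeFactors hp
    have hpd := (Nat.dvd_of_mem_primeFactors hp).trans hdv
    have a1 := (shiftSieve h M z h2).nu_pos_of_prime p hp' hpd
    have a2 := (shiftSieve h M z h2).nu_lt_one_of_prime p hp' hpd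
    exact (one_le_inv₀ (by linarith)).2 (by linarith)

/-- If p > z, then p and p + h are primes beyond z, so their product survives the sieve. The primes
p ≤ z account for the summand z. -/
theorem card_prime_pairs_le_sifted {h M z : ℕ} (h2 : 2 ∣ h) :
    (((range M).filter fun p => p.Prime ∧ (p + h).Prime).card : ℝ) ≤
      z + (shiftSieve h M z h2).siftedSum := by
  have hs : (shiftSieve h M z h2).siftedSum =
      (((range M).filter fun n => (primorial z).Coprime (n * (n + h))).card : ℝ) := by
    change ∑ n ∈ (range M).image (fun n => n * (n + h)),
      (if (primorial z).Coprime n then (1 : ℝ) else 0) = _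
    rw [sum_image ((strictMono_mul_add h).injective.injOn), ← sum_filter, sum_const, nsmul_eq_mul,
      mul_one]
  rw [hs]
  have hsub : ((range M).filter fun p => p.Prime ∧ (p + h).Prime) ⊆
      Icc 1 z ∪ (range M).filter fun n => (primorial z).Coprime (n * (n + h)) := by
    intro p hp
    obtain ⟨h1, h3, h4⟩ := mem_filter.1 hp
    rw [mem_union]
    by_cases hpz : p ≤ z
    · exact Or.inl (mem_Icc.2 ⟨h3.one_le, hpz⟩)
    · refine Or.inr (mem_filter.2 ⟨h1, ?_⟩)
      rw [primorial]
      refine Nat.Coprime.prod_left fun q hq => ?_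
      obtain ⟨hq1, hq2⟩ := mem_filter.1 hq
      have := mem_range.1 hq1
      refine Nat.Coprime.mul_right ?_ ?_
      · exact (Nat.coprime_primes hq2 h3).2 (by omega)
      · exact (Nat.coprime_primes hq2 h4).2 (by omega)
  have := (card_le_card hsub).trans (card_union_le _ _)
  rw [Nat.card_Icc, Nat.add_sub_cancel] at this
  exact_mod_cast this

theorem sqrt_le_div_log_sq {x : ℝ} (hx : 1 < x) : x ^ (1 / 2 : ℝ) ≤ 16 * (x / Real.log x ^ 2) := by
  have hx0 : 0 < x := by linarith
  have hl := Real.log_pos hx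
  have h1 := Real.log_le_rpow_div hx0.le (show (0 : ℝ) < 1 / 4 by norm_num)
  have h2 : Real.log x ^ 2 ≤ 16 * x ^ (1 / 2 : ℝ) := by
    calc Real.log x ^ 2 ≤ (x ^ (1 / 4 : ℝ) / (1 / 4)) ^ 2 := pow_le_pow_left₀ hl.le h1 2
      _ = 16 * (x ^ (1 / 4 : ℝ) * x ^ (1 / 4 : ℝ)) := by ring
      _ = _ := by rw [← Real.rpow_add hx0]; norm_num
  have h3 : x ^ (1 / 2 : ℝ) * x ^ (1 / 2 : ℝ) = x := by
    rw [← Real.rpow_add hx0]; norm_num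
  rw [← mul_div_assoc, le_div_iff₀ (by positivity)]
  have h4 : 0 ≤ x ^ (1 / 2 : ℝ) := by positivity
  calc _ ≤ x ^ (1 / 2 : ℝ) * (16 * x ^ (1 / 2 : ℝ)) := by gcongr
    _ = 16 * (x ^ (1 / 2 : ℝ) * x ^ (1 / 2 : ℝ)) := by ring
    _ = 16 * x := by rw [h3]

/-- The sieve bound for the number of prime pairs `p, p + h` with `p ≤ x`. -/
theorem card_prime_pairs_le {x : ℝ} (hx : 1 < x) {h : ℕ} (hh : 0 < h) :
    (((range (⌊x⌋₊ + 1)).filter fun p => p.Prime ∧ (p + h).Prime).card : ℝ) ≤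
      4128 * (x / Real.log x ^ 2) * singularFactor h := by
  have hx0 : 0 < x := by linarith
  have hl := Real.log_pos hx
  have hF := one_le_singularFactor h
  have hsqrt := sqrt_le_div_log_sq hx
  by_cases h2 : 2 ∣ h
  -- With this level z⁴ ≤ √x, so the remainder is absorbed, while y = √z still has ln (y + 1) ≥ (ln
  -- x) / 16.
  · set z := ⌊x ^ (1 / 8 : ℝ)⌋₊ with hz
    have hx8 : 1 ≤ x ^ (1 / 8 : ℝ) := Real.one_le_rpow hx.le (by norm_num)
    have hz1 : 1 ≤ z := Nat.le_floor (by exact_mod_cast hx8)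
    have hzx : (z : ℝ) ≤ x ^ (1 / 8 : ℝ) := Nat.floor_le (by positivity)
    have hyz : z.sqrt ^ 2 ≤ z := Nat.sqrt_le' z
    set s := shiftSieve h (⌊x⌋₊ + 1) z h2 with hs
    have hsq : ∀ d, d ∣ s.prodPrimes → Squarefree d := fun d hd =>
      BoundingSieve.squarefree_of_dvd_prodPrimes hd
    have hsieve := BoundingSieve.siftedSum_le_div_selbergSum (s := s) hz1 (fun d hd => by
      rw [hs, shiftSieve_nu h2 (hsq d hd)]
      have : (d : ℝ) ≠ 0 := by exact_mod_cast (hsq d hd).ne_zero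
      rw [mul_div_cancel₀ _ this]
      exact_mod_cast Nat.one_le_iff_ne_zero.2
        (prod_ne_zero_iff.2 fun p _ => (localRootCount_pos h p).ne'))
      (fun d hd => shiftSieve_rem h2 (hsq d hd))
    have hG := BoundingSieve.selbergSum_pos (s := s) hz1
    have hpair := card_prime_pairs_le_sifted (M := ⌊x⌋₊ + 1) (z := z) h2
    have hlow := (log_sq_le_singularFactor_mul hh.ne' hyz).trans
      (mul_le_mul_of_nonneg_left (sum_le_selbergSum_shiftSieve (M := ⌊x⌋₊ + 1) h2) (by positivity))
    have hlogy : Real.log x / 16 ≤ Real.log ((z.sqrt : ℝ) + 1) := by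
      have h3 : x ^ (1 / 8 : ℝ) ≤ ((z.sqrt : ℝ) + 1) ^ 2 := by
        have h4 : x ^ (1 / 8 : ℝ) < z + 1 := Nat.lt_floor_add_one _
        have h5 : z + 1 ≤ (z.sqrt + 1) ^ 2 := Nat.lt_succ_sqrt' z
        have h6 : (z : ℝ) + 1 ≤ ((z.sqrt : ℝ) + 1) ^ 2 := by exact_mod_cast h5
        linarith
      have h7 := Real.log_le_log (by positivity) h3
      rw [Real.log_rpow hx0, Real.log_pow] at h7
      push_cast at h7
      linarith
    -- Here 2048 = 8 · 16². With total mass at most 2 x the main term has 4096, and the remainder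
    -- adds 2 · 16 = 32.
    have hGl : Real.log x ^ 2 ≤ 2048 * singularFactor h * s.selbergSum z := by
      have := pow_le_pow_left₀ (by positivity) hlogy 2
      rw [div_pow] at this
      linarith
    have hmass : s.totalMass ≤ 2 * x := by
      change ((⌊x⌋₊ + 1 : ℕ) : ℝ) ≤ _
      have := Nat.floor_le hx0.le
      push_cast
      linarith
    have hmain : s.totalMass / s.selbergSum z ≤ 4096 * (x / Real.log x ^ 2) * singularFactor h := by
      rw [div_le_iff₀ hG]
      calc s.totalMass ≤ 2 * x := hmass
        _ = 2 * (x / Real.log x ^ 2) * Real.log x ^ 2 := by field_simp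
        _ ≤ 2 * (x / Real.log x ^ 2) * (2048 * singularFactor h * s.selbergSum z) := by gcongr
        _ = _ := by ring
    have hz4 : (z : ℝ) ^ 4 ≤ x ^ (1 / 2 : ℝ) := by
      calc (z : ℝ) ^ 4 ≤ (x ^ (1 / 8 : ℝ)) ^ 4 := by gcongr
        _ = _ := by rw [← Real.rpow_natCast, ← Real.rpow_mul hx0.le]; norm_num
    have hz1R : (1 : ℝ) ≤ z := by exact_mod_cast hz1
    have hzz : (z : ℝ) ≤ (z : ℝ) ^ 4 := le_self_pow₀ hz1R (by norm_num)
    have herr : (z : ℝ) + (z : ℝ) ^ 4 ≤ 32 * (x / Real.log x ^ 2) * singularFactor h := by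
      calc (z : ℝ) + (z : ℝ) ^ 4 ≤ 32 * (x / Real.log x ^ 2) * 1 := by linarith
        _ ≤ _ := by gcongr
    linarith
  -- For odd h one of p and p + h is even, which forces p = 2.
  · have hcard : ((range (⌊x⌋₊ + 1)).filter fun p => p.Prime ∧ (p + h).Prime).card ≤ 1 := by
      rw [card_le_one]
      have htwo : ∀ p ∈ (range (⌊x⌋₊ + 1)).filter (fun p => p.Prime ∧ (p + h).Prime), p = 2 := by
        intro p hp
        obtain ⟨-, hp1, hp2⟩ := mem_filter.1 hp
        by_contra hne
        have o1 := hp1.eq_two_or_odd.resolve_left hne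
        have := hp1.two_le
        have o2 := hp2.eq_two_or_odd.resolve_left (by omega)
        omega
      intro a ha b hb
      rw [htwo a ha, htwo b hb]
    have h1 : (1 : ℝ) ≤ x ^ (1 / 2 : ℝ) := Real.one_le_rpow hx.le (by norm_num)
    calc _ ≤ (1 : ℝ) := by exact_mod_cast hcard
      _ ≤ 16 * (x / Real.log x ^ 2) := h1.trans hsqrt
      _ ≤ 4128 * (x / Real.log x ^ 2) * 1 := by
        have : 0 ≤ x / Real.log x ^ 2 := by positivity
        linarith
      _ ≤ _ := by gcongr

end Romanoff

/-! ### Reduction of the singular factor to small primes, and Chebyshev bounds. -/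

namespace Romanoff

open Finset

/-- Expand ln d over the primes p ∣ d and exchange sums. Writing d = p d', the sum over d is 1 / p
times a part of the full divisor sum. -/
theorem sum_divisors_log_div_le {n : ℕ} (hn : Squarefree n) :
    ∑ d ∈ n.divisors, Real.log d * (d : ℝ)⁻¹ ≤
      (∑ p ∈ n.primeFactors, Real.log p / p) * singularFactor n := by
  have h1 : ∀ d ∈ n.divisors, Real.log d * (d : ℝ)⁻¹ =
      ∑ p ∈ n.primeFactors, if p ∣ d then Real.log p * (d : ℝ)⁻¹ else 0 := by
    intro d hd
    have hdv := (Nat.mem_divisors.1 hd).1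
    have hset : n.primeFactors.filter (· ∣ d) = d.primeFactors := by
      ext p
      simp only [mem_filter, Nat.mem_primeFactors]
      constructor
      · rintro ⟨⟨a, -, -⟩, b⟩; exact ⟨a, b, (Nat.pos_of_mem_divisors hd).ne'⟩
      · rintro ⟨a, b, -⟩; exact ⟨⟨a, b.trans hdv, hn.ne_zero⟩, b⟩
    rw [← sum_filter, hset, ← sum_mul]
    congr 1
    conv_lhs => rw [← Nat.prod_primeFactors_of_squarefree (hn.squarefree_of_dvd hdv)]
    push_cast
    rw [Real.log_prod fun p hp => by exact_mod_cast (Nat.prime_of_mem_primeFactors hp).ne_zero]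
  rw [sum_congr rfl h1, sum_comm, sum_mul]
  refine sum_le_sum fun p hp => ?_
  have hp' := Nat.prime_of_mem_primeFactors hp
  have hpR : (p : ℝ) ≠ 0 := by exact_mod_cast hp'.ne_zero
  have hlog : 0 ≤ Real.log p := Real.log_natCast_nonneg p
  rw [← sum_filter, ← mul_sum, div_mul_eq_mul_div, mul_div_assoc]
  refine mul_le_mul_of_nonneg_left ?_ hlog
  rw [← sum_divisors_inv hn, sum_div]
  refine sum_le_sum_of_injOn (fun d => d / p) (fun d hd => ?_) (fun a ha b hb hab => ?_)
    (fun d hd => ?_) fun _ _ => by positivity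
  · obtain ⟨h2, h3⟩ := mem_filter.1 hd
    exact Nat.mem_divisors.2
      ⟨(Nat.div_dvd_of_dvd h3).trans (Nat.mem_divisors.1 h2).1, hn.ne_zero⟩
  · rw [← Nat.div_mul_cancel (mem_filter.1 ha).2, ← Nat.div_mul_cancel (mem_filter.1 hb).2]
    exact congrArg (· * p) hab
  · obtain ⟨h2, h3⟩ := mem_filter.1 hd
    refine le_of_eq ?_
    rw [Nat.cast_div h3 hpR, inv_div, div_div, mul_comm, ← div_div, div_self hpR, one_div]

/-- Let T be the sum on the right. Under the weights 1 / d the mean of ln d over the divisors is at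
most T, so by Markov's inequality the divisors with ln d > 2 T carry at most half of the total
weight. The others are integers up to exp(2 T) and weigh at most 1 + 2 T. -/
theorem singularFactor_le_two_add {n : ℕ} (hn : Squarefree n) :
    singularFactor n ≤ 2 + 4 * ∑ p ∈ n.primeFactors, Real.log p / p := by
  set T := ∑ p ∈ n.primeFactors, Real.log p / p with hT
  have hTnn : 0 ≤ T := sum_nonneg fun p _ => by
    have := Real.log_natCast_nonneg p
    positivity
  by_cases hT0 : T = 0
  · have : n.primeFactors = ∅ := by
      by_contra hne
      obtain ⟨p, hp⟩ := nonempty_iff_ne_empty.2 hne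
      have hp' := Nat.prime_of_mem_primeFactors hp
      have hpos : 0 < Real.log p / p :=
        div_pos (Real.log_pos (by exact_mod_cast hp'.one_lt)) (by exact_mod_cast hp'.pos)
      have := single_le_sum (f := fun p : ℕ => Real.log p / p) (fun q _ => by
        have := Real.log_natCast_nonneg q
        positivity) hp
      linarith
    rw [singularFactor, this, prod_empty]
    linarith
  have hTpos : 0 < T := lt_of_le_of_ne hTnn (Ne.symm hT0)
  have hlarge : 2 * T * ∑ d ∈ n.divisors.filter (fun d : ℕ => ¬ Real.log d ≤ 2 * T), (d : ℝ)⁻¹ ≤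
      T * singularFactor n := by
    refine le_trans ?_ (sum_divisors_log_div_le hn)
    rw [mul_sum]
    refine le_trans (sum_le_sum fun d hd => ?_)
      (sum_le_sum_of_subset_of_nonneg (filter_subset _ _) fun d _ _ => ?_)
    · have := (mem_filter.1 hd).2
      exact mul_le_mul_of_nonneg_right (by linarith) (by positivity)
    · exact mul_nonneg (Real.log_natCast_nonneg d) (by positivity)
  have hsmall : ∑ d ∈ n.divisors.filter (fun d : ℕ => Real.log d ≤ 2 * T), (d : ℝ)⁻¹ ≤ 1 + 2 * T := by
    have h1 : (1 : ℝ) ≤ Real.exp (2 * T) := Real.one_le_exp (by linarith)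
    have h2 := harmonic_floor_le_one_add_log _ h1
    rw [Real.log_exp, harmonic_eq_sum_Icc] at h2
    push_cast at h2
    refine le_trans (sum_le_sum_of_subset_of_nonneg ?_ fun _ _ _ => by positivity) h2
    intro d hd
    obtain ⟨h3, h4⟩ := mem_filter.1 hd
    have hd0 := Nat.pos_of_mem_divisors h3
    exact mem_Icc.2 ⟨hd0, Nat.le_floor ((Real.log_le_iff_le_exp (by exact_mod_cast hd0)).1 h4)⟩
  have hsplit := sum_filter_add_sum_filter_not n.divisors (fun d : ℕ => Real.log d ≤ 2 * T)
    (fun d : ℕ => (d : ℝ)⁻¹)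
  rw [sum_divisors_inv hn] at hsplit
  have h5 : 2 * ∑ d ∈ n.divisors.filter (fun d : ℕ => ¬ Real.log d ≤ 2 * T), (d : ℝ)⁻¹ ≤ singularFactor n := by
    refine le_of_mul_le_mul_left ?_ hTpos
    linarith
  linarith

theorem prod_one_add_inv_le_two_add {S : Finset ℕ} (hS : ∀ p ∈ S, p.Prime) :
    ∏ p ∈ S, (1 + (p : ℝ)⁻¹) ≤ 2 + 4 * ∑ p ∈ S, Real.log p / p := by
  have hsq : Squarefree (∏ p ∈ S, p) :=
    Finset.squarefree_prod_of_pairwise_isCoprime (fun p hp q hq hpq =>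
      Nat.coprime_iff_isRelPrime.1 ((Nat.coprime_primes (hS p hp) (hS q hq)).2 hpq))
      fun p hp => (hS p hp).prime.squarefree
  have h := singularFactor_le_two_add hsq
  rwa [singularFactor, Nat.primeFactors_prod hS] at h

/-- The upper bound in Mertens' first theorem. -/
theorem sum_log_div_prime_le (n : ℕ) :
    ∑ p ∈ (Icc 1 n).filter Nat.Prime, Real.log p / p ≤ Real.log n + Real.log 4 := by
  rcases Nat.eq_zero_or_pos n with rfl | hn
  · simp [Real.log_nonneg]
  have hnR : (0 : ℝ) < n := by exact_mod_cast hn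
  have h1 : ∑ m ∈ Icc 1 n, Real.log m ≤ n * Real.log n := by
    calc ∑ m ∈ Icc 1 n, Real.log m ≤ ∑ m ∈ Icc 1 n, Real.log n := by
          refine sum_le_sum fun m hm => ?_
          obtain ⟨a, b⟩ := mem_Icc.1 hm
          exact Real.log_le_log (by exact_mod_cast a) (by exact_mod_cast b)
      _ = _ := by simp
  have h2 : ∑ p ∈ (Icc 1 n).filter Nat.Prime, ((n / p : ℕ) : ℝ) * Real.log p ≤
      ∑ m ∈ Icc 1 n, Real.log m := by
    have h3 : ∀ p ∈ (Icc 1 n).filter Nat.Prime, ((n / p : ℕ) : ℝ) * Real.log p =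
        ∑ m ∈ Icc 1 n, if p ∣ m then Real.log p else 0 := by
      intro p _
      rw [← sum_filter, sum_const, nsmul_eq_mul]
      congr 2
      exact (Nat.Ioc_filter_dvd_card_eq_div n p).symm
    rw [sum_congr rfl h3, sum_comm]
    refine sum_le_sum fun m hm => ?_
    obtain ⟨a, b⟩ := mem_Icc.1 hm
    have hset : ((Icc 1 n).filter Nat.Prime).filter (· ∣ m) = m.primeFactors := by
      ext p
      simp only [mem_filter, mem_Icc, Nat.mem_primeFactors]
      constructor
      · rintro ⟨⟨-, c⟩, d⟩; exact ⟨c, d, by omega⟩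
      · rintro ⟨c, d, -⟩; exact ⟨⟨⟨c.one_le, (Nat.le_of_dvd a d).trans b⟩, c⟩, d⟩
    rw [← sum_filter, hset,
      ← Real.log_prod fun p hp => by exact_mod_cast (Nat.prime_of_mem_primeFactors hp).ne_zero,
      ← Nat.cast_prod]
    exact Real.log_le_log
      (by exact_mod_cast prod_pos fun p hp => (Nat.prime_of_mem_primeFactors hp).pos)
      (by exact_mod_cast Nat.le_of_dvd a (Nat.prod_primeFactors_dvd m))
  have h4 : ∑ p ∈ (Icc 1 n).filter Nat.Prime, Real.log p ≤ Real.log 4 * n := by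
    have := Chebyshev.theta_le_log4_mul_x hnR.le
    rw [Chebyshev.theta_eq_sum_Icc, Nat.floor_natCast] at this
    refine le_trans (sum_le_sum_of_subset_of_nonneg ?_ fun p _ _ => Real.log_natCast_nonneg p) this
    intro p hp
    simp only [mem_filter, mem_Icc] at hp ⊢
    exact ⟨⟨by omega, hp.1.2⟩, hp.2⟩
  have h5 : n * ∑ p ∈ (Icc 1 n).filter Nat.Prime, Real.log p / p ≤
      ∑ p ∈ (Icc 1 n).filter Nat.Prime, ((n / p : ℕ) : ℝ) * Real.log p +
        ∑ p ∈ (Icc 1 n).filter Nat.Prime, Real.log p := by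
    rw [mul_sum, ← sum_add_distrib]
    refine sum_le_sum fun p hp => ?_
    have hp' := (mem_filter.1 hp).2
    have hpR : (0 : ℝ) < p := by exact_mod_cast hp'.pos
    have h6 : (n : ℝ) / p ≤ ((n / p : ℕ) : ℝ) + 1 := by
      have := Nat.lt_floor_add_one ((n : ℝ) / p)
      rw [Nat.floor_div_eq_div] at this
      exact this.le
    calc (n : ℝ) * (Real.log p / p) = (n : ℝ) / p * Real.log p := by ring
      _ ≤ (((n / p : ℕ) : ℝ) + 1) * Real.log p :=
          mul_le_mul_of_nonneg_right h6 (Real.log_natCast_nonneg p)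
      _ = _ := by ring
  refine le_of_mul_le_mul_left ?_ hnR
  linarith

theorem card_primeFactors_mul_log_two_le {h : ℕ} (hh : 0 < h) :
    (h.primeFactors.card : ℝ) * Real.log 2 ≤ Real.log h := by
  have h1 : 2 ^ h.primeFactors.card ≤ h := by
    calc 2 ^ h.primeFactors.card = ∏ p ∈ h.primeFactors, 2 := by simp
      _ ≤ ∏ p ∈ h.primeFactors, p :=
          prod_le_prod' fun p hp => (Nat.prime_of_mem_primeFactors hp).two_le
      _ ≤ h := Nat.le_of_dvd hh (Nat.prod_primeFactors_dvd h)
  rw [← Real.log_pow]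
  exact Real.log_le_log (by positivity) (by exact_mod_cast h1)

theorem two_le_log {x : ℝ} (hx : 10 ≤ x) : 2 ≤ Real.log x := by
  rw [Real.le_log_iff_exp_le (by linarith)]
  have h := Real.exp_one_lt_d9
  have h2 : Real.exp 2 = Real.exp 1 ^ 2 := by rw [← Real.exp_nat_mul]; norm_num
  rw [h2]
  have := pow_le_pow_left₀ (Real.exp_pos 1).le h.le 2
  norm_num at this ⊢
  linarith

/-- Let L = ln x. At most L / ln 2 primes divide h, so those above L contribute at most 1 / ln 2 ≤
2. For primes between L^α and L, 1 / p ≤ (ln p / p) / (α ln L), and Mertens' bound ln L + ln 4 ≤ 3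
ln L gives 3 / α. -/
theorem sum_large_primeFactors_inv_le {α x : ℝ} (hα : 0 < α) (hx : 10 ≤ x) {h : ℕ} (hh : 0 < h)
    (hhx : (h : ℝ) ≤ x) :
    ∑ p ∈ h.primeFactors with ¬ p ≤ ⌊Real.log x ^ α⌋₊, (p : ℝ)⁻¹ ≤ 2 + 3 / α := by
  have hL := two_le_log hx
  set L := Real.log x with hLdef
  have hL0 : 0 < L := by linarith
  have hlog2 := Real.log_two_gt_d9
  have hlL : Real.log 2 ≤ Real.log L := Real.log_le_log (by norm_num) hL
  rw [← sum_filter_add_sum_filter_not _ (fun p : ℕ => (p : ℝ) ≤ L)]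
  have hbig : ∑ p ∈ (h.primeFactors.filter fun p => ¬ p ≤ ⌊L ^ α⌋₊).filter
      (fun p : ℕ => ¬ (p : ℝ) ≤ L), (p : ℝ)⁻¹ ≤ 2 := by
    calc _ ≤ ∑ p ∈ (h.primeFactors.filter fun p => ¬ p ≤ ⌊L ^ α⌋₊).filter
            (fun p : ℕ => ¬ (p : ℝ) ≤ L), L⁻¹ := by
          refine sum_le_sum fun p hp => ?_
          have := (mem_filter.1 hp).2
          exact inv_anti₀ hL0 (by linarith)
      _ ≤ ∑ p ∈ h.primeFactors, L⁻¹ :=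
          sum_le_sum_of_subset_of_nonneg ((filter_subset _ _).trans (filter_subset _ _))
            fun _ _ _ => by positivity
      _ = h.primeFactors.card * L⁻¹ := by simp
      _ ≤ 2 := by
          have h1 := card_primeFactors_mul_log_two_le hh
          have h2 : Real.log h ≤ L := Real.log_le_log (by exact_mod_cast hh) hhx
          have h3 : (0 : ℝ) ≤ h.primeFactors.card := by positivity
          rw [← div_eq_mul_inv, div_le_iff₀ hL0]
          nlinarith
  have hmid : ∑ p ∈ (h.primeFactors.filter fun p => ¬ p ≤ ⌊L ^ α⌋₊).filter
      (fun p : ℕ => (p : ℝ) ≤ L), (p : ℝ)⁻¹ ≤ 3 / α := by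
    have hlLpos : 0 < Real.log L := by linarith
    calc _ ≤ ∑ p ∈ (h.primeFactors.filter fun p => ¬ p ≤ ⌊L ^ α⌋₊).filter
            (fun p : ℕ => (p : ℝ) ≤ L), (α * Real.log L)⁻¹ * (Real.log p / p) := by
          refine sum_le_sum fun p hp => ?_
          have h1 := (mem_filter.1 (mem_filter.1 hp).1).2
          have h2 : L ^ α < p := (Nat.floor_lt (by positivity)).1 (not_le.1 h1)
          have h3 : α * Real.log L ≤ Real.log p := by
            rw [← Real.log_rpow hL0]
            exact Real.log_le_log (by positivity) h2.le
          have h4 : (0 : ℝ) < p := lt_trans (by positivity) h2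
          rw [inv_mul_eq_div, le_div_iff₀ (by positivity), inv_mul_eq_div]
          gcongr
      _ ≤ ∑ p ∈ (Icc 1 ⌊L⌋₊).filter Nat.Prime, (α * Real.log L)⁻¹ * (Real.log p / p) := by
          refine sum_le_sum_of_subset_of_nonneg ?_ fun p _ _ => ?_
          · intro p hp
            have hp' := Nat.prime_of_mem_primeFactors (mem_filter.1 (mem_filter.1 hp).1).1
            exact mem_filter.2 ⟨mem_Icc.2 ⟨hp'.one_le, Nat.le_floor (mem_filter.1 hp).2⟩, hp'⟩
          · have := Real.log_natCast_nonneg p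
            positivity
      _ ≤ (α * Real.log L)⁻¹ * (Real.log L + Real.log 4) := by
          rw [← mul_sum]
          refine mul_le_mul_of_nonneg_left ((sum_log_div_prime_le _).trans ?_) (by positivity)
          gcongr
          · exact_mod_cast Nat.floor_pos.2 (by linarith)
          · exact Nat.floor_le hL0.le
      _ ≤ (α * Real.log L)⁻¹ * (3 * Real.log L) := by
          have : Real.log 4 = 2 * Real.log 2 := by
            rw [show (4 : ℝ) = 2 ^ 2 by norm_num, Real.log_pow]; norm_num
          gcongr
          linarith
      _ = 3 / α := by field_simp
  linarith

theorem singularFactor_le {α x : ℝ} (hα : 0 < α) (hx : 10 ≤ x) {h : ℕ} (hh : 0 < h)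
    (hhx : (h : ℝ) ≤ x) :
    singularFactor h ≤ Real.exp (2 + 3 / α) *
      (2 + 4 * ∑ p ∈ (Icc 1 ⌊Real.log x ^ α⌋₊).filter Nat.Prime,
        if p ∣ h then Real.log p / p else 0) := by
  set Y := ⌊Real.log x ^ α⌋₊
  have hset : ((Icc 1 Y).filter Nat.Prime).filter (· ∣ h) = h.primeFactors.filter (· ≤ Y) := by
    ext p
    simp only [mem_filter, mem_Icc, Nat.mem_primeFactors]
    constructor
    · rintro ⟨⟨⟨-, a⟩, b⟩, c⟩; exact ⟨⟨b, c, hh.ne'⟩, a⟩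
    · rintro ⟨⟨b, c, -⟩, a⟩; exact ⟨⟨⟨b.one_le, a⟩, b⟩, c⟩
  rw [singularFactor, ← prod_filter_mul_prod_filter_not _ (fun p => p ≤ Y), ← sum_filter, hset,
    mul_comm]
  refine mul_le_mul ?_ (prod_one_add_inv_le_two_add fun p hp =>
    Nat.prime_of_mem_primeFactors (mem_filter.1 hp).1)
    (prod_nonneg fun _ _ => by positivity) (Real.exp_pos _).le
  calc ∏ p ∈ h.primeFactors with ¬ p ≤ Y, (1 + (p : ℝ)⁻¹)
      ≤ ∏ p ∈ h.primeFactors with ¬ p ≤ Y, Real.exp (p : ℝ)⁻¹ :=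
        prod_le_prod (fun _ _ => by positivity) fun p _ => by
          rw [add_comm]; exact Real.add_one_le_exp _
    _ = Real.exp (∑ p ∈ h.primeFactors with ¬ p ≤ Y, (p : ℝ)⁻¹) := (Real.exp_sum _ _).symm
    _ ≤ _ := Real.exp_le_exp.2 (sum_large_primeFactors_inv_le hα hx hh hhx)

/-- A lower bound of Chebyshev type for the number of primes up to `x / 2`. -/
theorem le_primeCounting_half {x : ℝ} (hx : 10 ≤ x) :
    x / 20 / Real.log x ≤ Nat.primeCounting ⌊x / 2⌋₊ := by
  have hy1 : 1 < x / 2 := by linarith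
  refine le_trans ?_ (Chebyshev.pi_ge' hy1)
  have h2 := Real.log_two_gt_d9
  have h2' := Real.log_two_lt_d9
  -- The tangent to the logarithm at 8 is close enough from x = 10 on.
  have hlog : Real.log (x / 2 + 2) ≤ (x / 2 + 2) / 8 - 1 + 3 * Real.log 2 := by
    have h3 := Real.log_le_sub_one_of_pos (show 0 < (x / 2 + 2) / 8 by linarith)
    rw [Real.log_div (by linarith) (by norm_num),
      show (8 : ℝ) = 2 ^ 3 by norm_num, Real.log_pow] at h3
    push_cast at h3
    norm_num at h3 ⊢
    linarith
  have hnum : x / 20 ≤ (x / 2 - 1) * Real.log 2 - Real.log (x / 2 + 2) := by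
    nlinarith
  have hlx : Real.log (x / 2) ≤ Real.log x := Real.log_le_log (by linarith) (by linarith)
  have hpos := Real.log_pos hy1
  have hnn : 0 ≤ (x / 2 - 1) * Real.log 2 - Real.log (x / 2 + 2) := by linarith
  gcongr

theorem primeCounting_le {x : ℝ} (hx : 10 ≤ x) :
    (Nat.primeCounting ⌊x⌋₊ : ℝ) ≤ 5 * (x / Real.log x) := by
  have hx0 : 0 < x := by linarith
  have hL := two_le_log hx
  have h := Chebyshev.pi_le_log4_mul_div (show 1 < x by linarith)
  rw [Real.log_sqrt hx0.le] at h
  have h1 : Real.log x ≤ 2 * √x := by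
    have := Real.log_le_sub_one_of_pos (Real.sqrt_pos.2 hx0)
    rw [Real.log_sqrt hx0.le] at this
    linarith
  have h2 : √x ≤ 2 * (x / Real.log x) := by
    rw [← mul_div_assoc, le_div_iff₀ (by linarith)]
    nlinarith [Real.mul_self_sqrt hx0.le, Real.sqrt_nonneg x]
  have h3 : Real.log 4 ≤ 1.4 := by
    rw [show (4 : ℝ) = 2 ^ 2 by norm_num, Real.log_pow]
    have := Real.log_two_lt_d9
    push_cast
    linarith
  have h4 : Real.log 4 * x / (Real.log x / 2) = 2 * Real.log 4 * (x / Real.log x) := by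
    field_simp
  have h5 : 0 ≤ x / Real.log x := by positivity
  rw [h4] at h
  nlinarith

end Romanoff

/-! ### Second moments, coincidences and finite forms of the counting functions. -/

namespace Romanoff

open Finset

/-- If a nonnegative function has a large mean and a bounded second moment, then it is large at
many points. -/
theorem sq_le_card_mul_of_second_moment {ι : Type*} (E : Finset ι) (r : ι → ℝ) {S Q t : ℝ}
    (hS : 0 ≤ S) (hsum : 2 * S ≤ ∑ n ∈ E, r n) (ht : t * E.card ≤ S)
    (hQ : ∑ n ∈ E, r n ^ 2 ≤ Q) :
    S ^ 2 ≤ (E.filter fun n => t ≤ r n).card * Q := by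
  -- Points below the threshold carry at most S, so at least S of the total 2 S remains for
  -- Cauchy–Schwarz. The maximum with 0 covers negative t.
  have h1 : ∑ n ∈ E with ¬ t ≤ r n, r n ≤ S ⊔ 0 := by
    calc ∑ n ∈ E with ¬ t ≤ r n, r n ≤ ∑ n ∈ E with ¬ t ≤ r n, t :=
          sum_le_sum fun n hn => (not_le.1 (mem_filter.1 hn).2).le
      _ = (E.filter fun n => ¬ t ≤ r n).card * t := by simp
      _ ≤ S ⊔ 0 := by
          rcases le_total 0 t with h0 | h0
          · refine le_trans ?_ (le_max_left _ _)
            have : ((E.filter fun n => ¬ t ≤ r n).card : ℝ) ≤ E.card := by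
              exact_mod_cast card_filter_le _ _
            nlinarith
          · exact le_trans (mul_nonpos_of_nonneg_of_nonpos (by positivity) h0) (le_max_right _ _)
  rw [max_eq_left hS] at h1
  have h2 : S ≤ ∑ n ∈ E with t ≤ r n, r n := by
    have := sum_filter_add_sum_filter_not E (fun n => t ≤ r n) r
    linarith
  calc S ^ 2 ≤ (∑ n ∈ E with t ≤ r n, r n) ^ 2 := pow_le_pow_left₀ hS h2 2
    _ ≤ (E.filter fun n => t ≤ r n).card * ∑ n ∈ E with t ≤ r n, r n ^ 2 :=
        sq_sum_le_card_mul_sum_sq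
    _ ≤ _ := by
        refine mul_le_mul_of_nonneg_left (le_trans ?_ hQ) (by positivity)
        exact sum_le_sum_of_subset_of_nonneg (filter_subset _ _) fun _ _ _ => sq_nonneg _

/-- The square of a fibre's size counts the ordered pairs inside that fibre. -/
theorem sum_card_fiber_sq_le {ι : Type*} (W : Finset ι) (f : ι → ℕ) (E : Finset ℕ) :
    ∑ n ∈ E, ((W.filter fun w => f w = n).card : ℝ) ^ 2 ≤
      (((W ×ˢ W).filter fun q => f q.1 = f q.2).card : ℝ) := by
  classical
  have h1 : ∀ n ∈ E, (W.filter fun w => f w = n).card ^ 2 =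
      (((W ×ˢ W).filter fun q => f q.1 = f q.2 ∧ f q.1 ∈ E).filter fun q => f q.1 = n).card := by
    intro n hn
    rw [sq, ← card_product]
    congr 1
    ext q
    simp only [mem_product, mem_filter]
    constructor
    · rintro ⟨⟨a, b⟩, c, d⟩
      exact ⟨⟨⟨a, c⟩, by rw [b, d], by rw [b]; exact hn⟩, b⟩
    · rintro ⟨⟨⟨a, c⟩, e, -⟩, b⟩
      exact ⟨⟨a, b⟩, c, by rw [← e, b]⟩
  have h2 := card_eq_sum_card_fiberwise (s := (W ×ˢ W).filter fun q => f q.1 = f q.2 ∧ f q.1 ∈ E)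
    (f := fun q => f q.1) (t := E) (fun q hq => (mem_filter.1 hq).2.2)
  have h3 : ∑ n ∈ E, (W.filter fun w => f w = n).card ^ 2 ≤
      ((W ×ˢ W).filter fun q => f q.1 = f q.2).card := by
    rw [sum_congr rfl h1, ← h2]
    exact card_le_card (monotone_filter_right _ fun q _ hq => hq.1)
  exact_mod_cast h3

/-- Coincidences `p + a_j = q + a_k` among pairs from `P × J`, counted for each pair `(j, k)`. -/
theorem card_coincidences_le (a : ℕ → ℕ) (P J : Finset ℕ) :
    (((P ×ˢ J) ×ˢ (P ×ˢ J)).filter fun q => q.1.1 + a q.1.2 = q.2.1 + a q.2.2).card ≤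
      (∑ k ∈ J, (J.filter fun j => a j = a k).card) * P.card +
      2 * ∑ k ∈ J, ∑ j ∈ J with a k < a j, (P.filter fun p => p + (a j - a k) ∈ P).card := by
  classical
  set X := ((P ×ˢ J) ×ˢ (P ×ˢ J)).filter fun q => q.1.1 + a q.1.2 = q.2.1 + a q.2.2
  -- Split by the sign of a_j - a_k. In each part one prime and the indices determine the other
  -- prime, and `V` is the mirror image of `U`, hence the factor 2.
  set D := X.filter fun q => a q.1.2 = a q.2.2
  set U := X.filter fun q => a q.2.2 < a q.1.2
  set V := X.filter fun q => a q.1.2 < a q.2.2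
  have hX : X ⊆ D ∪ (U ∪ V) := by
    intro q hq
    simp only [D, U, V, mem_union, mem_filter, hq, true_and]
    omega
  have hD : D.card ≤ (∑ k ∈ J, (J.filter fun j => a j = a k).card) * P.card := by
    rw [← card_sigma, ← card_product]
    refine card_le_card_of_injOn (fun q => (⟨q.2.2, q.1.2⟩, q.1.1)) ?_ ?_
    · intro q hq
      simp only [D, X, coe_filter, mem_filter, mem_product, Set.mem_ofPred_eq] at hq
      simp only [coe_product, Set.mem_prod, mem_coe, mem_sigma, mem_filter]
      tauto
    · rintro ⟨⟨p, j⟩, ⟨q, k⟩⟩ h1 ⟨⟨p', j'⟩, ⟨q', k'⟩⟩ h2 heq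
      simp only [D, X, coe_filter, mem_filter, Set.mem_ofPred_eq] at h1 h2
      simp only [Prod.mk.injEq, Sigma.mk.injEq, heq_eq_eq] at heq
      obtain ⟨⟨rfl, rfl⟩, rfl⟩ := heq
      have : q = q' := by omega
      rw [this]
  have hU : U.card ≤ ∑ k ∈ J, ∑ j ∈ J with a k < a j,
      (P.filter fun p => p + (a j - a k) ∈ P).card := by
    rw [sum_sigma', ← card_sigma]
    refine card_le_card_of_injOn (fun q => ⟨⟨q.2.2, q.1.2⟩, q.1.1⟩) ?_ ?_
    · rintro ⟨⟨p, j⟩, ⟨q, k⟩⟩ hq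
      simp only [U, X, coe_filter, mem_filter, mem_product, Set.mem_ofPred_eq] at hq
      obtain ⟨⟨⟨⟨hp, hj⟩, hq, hk⟩, he⟩, hlt⟩ := hq
      have : p + (a j - a k) = q := by omega
      simp only [mem_coe, mem_sigma, mem_filter, this]
      exact ⟨⟨hk, hj, hlt⟩, hp, hq⟩
    · rintro ⟨⟨p, j⟩, ⟨q, k⟩⟩ h1 ⟨⟨p', j'⟩, ⟨q', k'⟩⟩ h2 heq
      simp only [U, X, coe_filter, mem_filter, Set.mem_ofPred_eq] at h1 h2
      simp only [Sigma.mk.injEq, heq_eq_eq] at heq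
      obtain ⟨⟨rfl, rfl⟩, rfl⟩ := heq
      have : q = q' := by omega
      rw [this]
  have hV : V.card ≤ U.card := by
    refine card_le_card_of_injOn Prod.swap ?_ Prod.swap_injective.injOn
    intro q hq
    simp only [V, U, X, coe_filter, mem_filter, mem_product, Set.mem_ofPred_eq, Prod.fst_swap,
      Prod.snd_swap] at hq ⊢
    exact ⟨⟨⟨hq.1.1.2, hq.1.1.1⟩, hq.1.2.symm⟩, hq.2⟩
  have h1 := card_le_card hX
  have h2 := card_union_le D (U ∪ V)
  have h3 := card_union_le U V
  omega

section Sequence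

variable {a : ℕ → ℕ}

theorem finite_setOf_le (hfin : ∀ n : ℕ, 0 < n → {j : ℕ | a j = n}.Finite)
    (hpos : ∀ j : ℕ, 0 < a j) (x : ℝ) : {j : ℕ | (a j : ℝ) ≤ x}.Finite := by
  have : {j : ℕ | (a j : ℝ) ≤ x} ⊆ ⋃ n ∈ Set.Icc 1 ⌊x⌋₊, {j : ℕ | a j = n} := by
    intro j hj
    simp only [Set.mem_iUnion, Set.mem_Icc, Set.mem_ofPred_eq, exists_prop, exists_eq_right']
    exact ⟨hpos j, Nat.le_floor hj⟩
  refine Set.Finite.subset (Set.Finite.biUnion (Set.finite_Icc _ _) fun n hn => hfin n ?_) this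
  exact (Set.mem_Icc.1 hn).1

variable (x : ℝ) {J : Finset ℕ}

theorem countUpTo_eq_card (hJ : ∀ j, j ∈ J ↔ (a j : ℝ) ≤ x) : countUpTo a x = J.card := by
  rw [countUpTo, ← Set.ncard_coe_finset]
  congr 1
  ext j
  simp [hJ]

theorem sum_multiplicity_le (hpos : ∀ j : ℕ, 0 < a j) (hJ : ∀ j, j ∈ J ↔ (a j : ℝ) ≤ x) :
    ∑ k ∈ J, (J.filter fun j => a j = a k).card ≤ J.card * maxMultiplicity a x := by
  rw [← smul_eq_mul, ← sum_const]
  refine sum_le_sum fun k hk => ?_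
  have hk' := (hJ k).1 hk
  have h1 : (J.filter fun j => a j = a k).card = multiplicity a (a k) := by
    rw [multiplicity, ← Set.ncard_coe_finset]
    congr 1
    ext j
    simp only [coe_filter, Set.mem_ofPred_eq, hJ, and_iff_right_iff_imp]
    intro h
    rwa [h]
  rw [h1]
  exact le_sup (f := multiplicity a) (mem_Icc.2 ⟨hpos k, Nat.le_floor hk'⟩)

/-- A congruence a_j ≡ a_k is divisibility of the difference, so exchanging j and p turns the
hypothesis into a sum over differences, the form in which `singularFactor_le` is applied. -/
theorem smallPrimeSum_eq (α : ℝ) (hJ : ∀ j, j ∈ J ↔ (a j : ℝ) ≤ x) :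
    smallPrimeSum a α x = ∑ k ∈ J, ∑ j ∈ J with a k < a j,
      ∑ p ∈ (Icc 1 ⌊Real.log x ^ α⌋₊).filter Nat.Prime,
        if p ∣ a j - a k then Real.log p / p else 0 := by
  have hcount : ∀ k p, congruenceCount a x k p =
      ((J.filter fun j => a k < a j).filter fun j => p ∣ a j - a k).card := by
    intro k p
    rw [congruenceCount, ← Set.ncard_coe_finset]
    congr 1
    ext j
    simp only [coe_filter, mem_filter, Set.mem_ofPred_eq, hJ]
    constructor
    · rintro ⟨h1, h2, h3⟩
      exact ⟨⟨h2, h1⟩, (Nat.modEq_iff_dvd' h1.le).1 h3.symm⟩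
    · rintro ⟨⟨h2, h1⟩, h3⟩
      exact ⟨h1, h2, ((Nat.modEq_iff_dvd' h1.le).2 h3).symm⟩
  have hinner : ∀ k, ∑ p ∈ (Icc 1 ⌊Real.log x ^ α⌋₊).filter Nat.Prime,
        (congruenceCount a x k p : ℝ) * Real.log p / p =
      ∑ j ∈ J with a k < a j, ∑ p ∈ (Icc 1 ⌊Real.log x ^ α⌋₊).filter Nat.Prime,
        if p ∣ a j - a k then Real.log p / p else 0 := by
    intro k
    rw [sum_comm]
    refine sum_congr rfl fun p _ => ?_
    rw [← sum_filter, sum_const, nsmul_eq_mul, hcount, mul_div_assoc]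
  rw [smallPrimeSum, ← finsum_mem_coe_finset]
  refine finsum_congr fun k => ?_
  by_cases hk : (a k : ℝ) < x
  · rw [finsum_eq_if, finsum_eq_if, if_pos hk, if_pos (mem_coe.2 ((hJ k).2 hk.le)), hinner]
  · rw [finsum_eq_if, finsum_eq_if, if_neg hk]
    -- An index with a_k = x lies in `J` but not in the original range. It contributes nothing, as
    -- no a_j satisfies x < a_j ≤ x.
    split_ifs with hkJ
    · rw [filter_false_of_mem, sum_empty]
      intro j hj hlt
      have h1 : (a k : ℝ) < a j := by exact_mod_cast hlt
      exact hk (h1.trans_le ((hJ j).1 hj))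
    · rfl

theorem reprCount_eq_card (hJ : ∀ j, j ∈ J ↔ (a j : ℝ) ≤ x) (hpos : ∀ j : ℕ, 0 < a j) {n : ℕ}
    (hn : n ∈ Icc 1 ⌊x⌋₊) :
    reprCount a n = (((range (⌊x⌋₊ + 1)).filter Nat.Prime ×ˢ J).filter
      fun w => w.1 + a w.2 = n).card := by
  rw [reprCount, ← Set.ncard_coe_finset]
  congr 1
  ext ⟨p, j⟩
  have hnx := (mem_Icc.1 hn).2
  simp only [Set.mem_ofPred_eq, coe_filter, mem_product, mem_filter, mem_range, hJ]
  constructor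
  · rintro ⟨h1, h2⟩
    refine ⟨⟨⟨by omega, h1⟩, ?_⟩, h2⟩
    have h0 : ⌊x⌋₊ ≠ 0 := by have := (mem_Icc.1 hn).1; omega
    exact (Nat.le_floor_iff' (hpos j).ne').1 (by omega)
  · rintro ⟨⟨⟨-, h1⟩, -⟩, h2⟩
    exact ⟨h1, h2⟩

end Sequence

end Romanoff

/-! ### The first two moments of r(n). -/

namespace Romanoff

open Finset

theorem card_filter_prime_range (n : ℕ) :
    ((range (n + 1)).filter Nat.Prime).card = Nat.primeCounting n := by
  rw [Nat.primeCounting, Nat.primeCounting', Nat.count_eq_card_filter_range]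

variable {a : ℕ → ℕ} {x : ℝ} {J : Finset ℕ}

theorem le_sum_reprCount (hpos : ∀ j : ℕ, 0 < a j) (hx : 10 ≤ x)
    (hJ : ∀ j, j ∈ J ↔ (a j : ℝ) ≤ x) :
    x / 20 / Real.log x * countUpTo a (x / 2) ≤ ∑ n ∈ Icc 1 ⌊x⌋₊, (reprCount a n : ℝ) := by
  classical
  set P := (range (⌊x⌋₊ + 1)).filter Nat.Prime
  set J' := J.filter fun j => (a j : ℝ) ≤ x / 2
  set P' := (range (⌊x / 2⌋₊ + 1)).filter Nat.Prime
  have hJ' : ∀ j, j ∈ J' ↔ (a j : ℝ) ≤ x / 2 := by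
    intro j
    simp only [J', mem_filter, hJ, and_iff_right_iff_imp]
    intro h; linarith
  have hsub : P' ×ˢ J' ⊆ (P ×ˢ J).filter fun w => w.1 + a w.2 ∈ Icc 1 ⌊x⌋₊ := by
    rintro ⟨p, j⟩ hw
    obtain ⟨h1, h2⟩ := mem_product.1 hw
    obtain ⟨h3, h4⟩ := mem_filter.1 h1
    have h5 := (hJ' j).1 h2
    have h6 : (p : ℝ) ≤ x / 2 := (Nat.le_floor_iff (by linarith)).1 (by
      have := mem_range.1 h3; omega)
    have h7 : p + a j ≤ ⌊x⌋₊ := Nat.le_floor (by push_cast; linarith)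
    simp only [mem_filter, mem_product, P, mem_range, mem_Icc]
    exact ⟨⟨⟨by omega, h4⟩, (mem_filter.1 h2).1⟩, by have := hpos j; omega, h7⟩
  have h1 := card_eq_sum_card_fiberwise
    (s := (P ×ˢ J).filter fun w => w.1 + a w.2 ∈ Icc 1 ⌊x⌋₊) (f := fun w => w.1 + a w.2)
    (t := Icc 1 ⌊x⌋₊) fun w hw => (mem_filter.1 hw).2
  have h2 : ∑ n ∈ Icc 1 ⌊x⌋₊, reprCount a n =
      ((P ×ˢ J).filter fun w => w.1 + a w.2 ∈ Icc 1 ⌊x⌋₊).card := by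
    rw [h1]
    refine sum_congr rfl fun n hn => ?_
    rw [reprCount_eq_card x hJ hpos hn, filter_filter]
    congr 1
    refine filter_congr fun w _ => ?_
    constructor
    · intro h; exact ⟨by rw [h]; exact hn, h⟩
    · exact fun h => h.2
  have h3 := card_le_card hsub
  rw [card_product, card_filter_prime_range, ← h2, ← countUpTo_eq_card _ hJ'] at h3
  calc _ ≤ (Nat.primeCounting ⌊x / 2⌋₊ : ℝ) * countUpTo a (x / 2) :=
        mul_le_mul_of_nonneg_right (le_primeCounting_half hx) (by positivity)
    _ ≤ _ := by exact_mod_cast h3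

/-- The 5 comes from π(x) ≤ 5 x / ln x on the diagonal. The 8256 = 2 · 4128 is the sieve constant
for both signs of the difference, and the remaining factor is the averaged singular factor. -/
theorem sum_reprCount_sq_le (hpos : ∀ j : ℕ, 0 < a j) (hx : 10 ≤ x)
    (hJ : ∀ j, j ∈ J ↔ (a j : ℝ) ≤ x) {γ α : ℝ} (hα : 0 < α) (hγ : 0 < γ)
    (hsmall : smallPrimeSum a α x ≤ γ * (countUpTo a x : ℝ) ^ 2) :
    ∑ n ∈ Icc 1 ⌊x⌋₊, (reprCount a n : ℝ) ^ 2 ≤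
      (5 + 8256 * Real.exp (2 + 3 / α) * (2 + 4 * γ)) * (x * countUpTo a x / Real.log x ^ 2) *
        (countUpTo a x + maxMultiplicity a x * Real.log x) := by
  classical
  have hL := two_le_log hx
  have hL0 : 0 < Real.log x := by linarith
  have hx0 : 0 < x := by linarith
  set P := (range (⌊x⌋₊ + 1)).filter Nat.Prime with hP
  set E := Real.exp (2 + 3 / α) with hE
  have hE0 : 0 < E := Real.exp_pos _
  have hN : (countUpTo a x : ℝ) = J.card := by rw [countUpTo_eq_card x hJ]
  have h1 : ∑ n ∈ Icc 1 ⌊x⌋₊, (reprCount a n : ℝ) ^ 2 ≤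
      ((((P ×ˢ J) ×ˢ (P ×ˢ J)).filter fun q =>
        q.1.1 + a q.1.2 = q.2.1 + a q.2.2).card : ℝ) := by
    refine le_trans (le_of_eq (sum_congr rfl fun n hn => ?_))
      (sum_card_fiber_sq_le (P ×ˢ J) (fun w => w.1 + a w.2) (Icc 1 ⌊x⌋₊))
    rw [reprCount_eq_card x hJ hpos hn]
  have h2 : ((((P ×ˢ J) ×ˢ (P ×ˢ J)).filter fun q =>
        q.1.1 + a q.1.2 = q.2.1 + a q.2.2).card : ℝ) ≤
      ((∑ k ∈ J, (J.filter fun j => a j = a k).card : ℕ) : ℝ) * P.card +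
      2 * ∑ k ∈ J, ∑ j ∈ J with a k < a j,
        ((P.filter fun p => p + (a j - a k) ∈ P).card : ℝ) := by
    exact_mod_cast card_coincidences_le a P J
  have hdiag : ((∑ k ∈ J, (J.filter fun j => a j = a k).card : ℕ) : ℝ) * P.card ≤
      (J.card * maxMultiplicity a x) * (5 * (x / Real.log x)) := by
    refine mul_le_mul (by exact_mod_cast sum_multiplicity_le x hpos hJ) ?_ (by positivity)
      (by positivity)
    rw [hP, card_filter_prime_range]
    exact primeCounting_le hx
  set B := 4128 * (x / Real.log x ^ 2) with hB
  have hB0 : 0 ≤ B := by positivity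
  set T : ℕ → ℕ → ℝ := fun k j => ∑ p ∈ (Icc 1 ⌊Real.log x ^ α⌋₊).filter Nat.Prime,
        if p ∣ a j - a k then Real.log p / p else 0 with hT
  have hoff : ∀ k ∈ J, ∀ j ∈ J.filter (fun j => a k < a j),
      ((P.filter fun p => p + (a j - a k) ∈ P).card : ℝ) ≤ B * E * (2 + 4 * T k j) := by
    intro k _ j hj
    obtain ⟨hj1, hj2⟩ := mem_filter.1 hj
    have hh : 0 < a j - a k := by omega
    have hhx : ((a j - a k : ℕ) : ℝ) ≤ x := by
      have : ((a j - a k : ℕ) : ℝ) ≤ a j := by exact_mod_cast Nat.sub_le _ _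
      exact this.trans ((hJ j).1 hj1)
    calc ((P.filter fun p => p + (a j - a k) ∈ P).card : ℝ)
        ≤ (((range (⌊x⌋₊ + 1)).filter fun p => p.Prime ∧ (p + (a j - a k)).Prime).card : ℝ) := by
          refine Nat.cast_le.2 (card_le_card fun p hp => ?_)
          obtain ⟨h3, h4⟩ := mem_filter.1 hp
          exact mem_filter.2 ⟨(mem_filter.1 h3).1, (mem_filter.1 h3).2, (mem_filter.1 h4).2⟩
      _ ≤ B * singularFactor (a j - a k) := card_prime_pairs_le (by linarith) hh
      _ ≤ B * (E * (2 + 4 * T k j)) := by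
          gcongr
          exact singularFactor_le hα hx hh hhx
      _ = _ := by ring
  have hsum : ∑ k ∈ J, ∑ j ∈ J with a k < a j,
      ((P.filter fun p => p + (a j - a k) ∈ P).card : ℝ) ≤
      B * E * ((2 + 4 * γ) * (J.card : ℝ) ^ 2) := by
    refine (sum_le_sum fun k hk => sum_le_sum fun j hj => hoff k hk j hj).trans ?_
    simp_rw [← mul_sum]
    refine mul_le_mul_of_nonneg_left ?_ (by positivity)
    simp_rw [sum_add_distrib, ← mul_sum]
    have h3 : ∑ k ∈ J, ∑ j ∈ J with a k < a j, T k j ≤ γ * (J.card : ℝ) ^ 2 := by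
      rw [← hN, hT]
      simp only
      rw [← smallPrimeSum_eq x α hJ]
      exact hsmall
    have h4 : ∑ k ∈ J, ∑ j ∈ J with a k < a j, (2 : ℝ) ≤ 2 * (J.card : ℝ) ^ 2 := by
      calc _ ≤ ∑ k ∈ J, ∑ j ∈ J, (2 : ℝ) := sum_le_sum fun k _ =>
            sum_le_sum_of_subset_of_nonneg (filter_subset _ _) fun _ _ _ => by norm_num
        _ = 2 * (J.card : ℝ) ^ 2 := by simp; ring
    linarith
  rw [hN]
  have hρ : (0 : ℝ) ≤ maxMultiplicity a x := by positivity
  set N : ℝ := (J.card : ℝ)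
  set ρ : ℝ := (maxMultiplicity a x : ℝ)
  have hN0 : 0 ≤ N := by positivity
  set M := x * N / Real.log x ^ 2 with hM
  have hM0 : 0 ≤ M := by positivity
  set K := 8256 * E * (2 + 4 * γ) with hK
  have hK0 : 0 ≤ K := by positivity
  have e1 : (N * ρ) * (5 * (x / Real.log x)) = 5 * M * (ρ * Real.log x) := by
    rw [hM]; field_simp
  have e2 : 2 * (B * E * ((2 + 4 * γ) * N ^ 2)) = K * M * N := by
    rw [hM, hK, hB]; ring
  calc _ ≤ 5 * M * (ρ * Real.log x) + K * M * N := by linarith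
    _ ≤ 5 * M * (N + ρ * Real.log x) + K * M * (N + ρ * Real.log x) := by
        have : 0 ≤ ρ * Real.log x := by positivity
        gcongr <;> linarith
    _ = _ := by ring

theorem card_filter_reprCount_ge (hpos : ∀ j : ℕ, 0 < a j) (hx : 10 ≤ x)
    (hJ : ∀ j, j ∈ J ↔ (a j : ℝ) ≤ x) {γ₁ γ₂ α : ℝ} (hα : 0 < α) (hγ₁ : 0 < γ₁) (hγ₂ : 0 < γ₂)
    (hN : 0 < countUpTo a x)
    (hhalf : γ₁ * (countUpTo a x : ℝ) ≤ countUpTo a (x / 2))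
    (hsmall : smallPrimeSum a α x ≤ γ₂ * (countUpTo a x : ℝ) ^ 2) :
    γ₁ ^ 2 / (1600 * (5 + 8256 * Real.exp (2 + 3 / α) * (2 + 4 * γ₂))) * x *
        ((countUpTo a x : ℝ) / (countUpTo a x + maxMultiplicity a x * Real.log x)) ≤
      (((Icc 1 ⌊x⌋₊).filter fun n =>
        γ₁ / 40 * ((countUpTo a x : ℝ) / Real.log x) ≤ (reprCount a n : ℝ)).card : ℝ) := by
  have hL := two_le_log hx
  have hL0 : 0 < Real.log x := by linarith
  have hx0 : 0 < x := by linarith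
  have hfirst := le_sum_reprCount hpos hx hJ
  have hsecond := sum_reprCount_sq_le hpos hx hJ hα hγ₂ hsmall
  have hN0 : (0 : ℝ) < countUpTo a x := by exact_mod_cast hN
  set N : ℝ := (countUpTo a x : ℝ)
  set ρ : ℝ := (maxMultiplicity a x : ℝ) with hρdef
  have hρ0 : 0 ≤ ρ := by positivity
  set K := 5 + 8256 * Real.exp (2 + 3 / α) * (2 + 4 * γ₂) with hK
  have hK0 : 0 < K := by have := Real.exp_pos (2 + 3 / α); positivity
  -- Half of the lower bound for the first moment. Its square produces the 1600 = 40².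
  set S := γ₁ / 40 * (N / Real.log x) * x with hS
  have hS0 : 0 ≤ S := by positivity
  have hmean : 2 * S ≤ ∑ n ∈ Icc 1 ⌊x⌋₊, (reprCount a n : ℝ) := by
    refine le_trans ?_ hfirst
    calc 2 * S = x / 20 / Real.log x * (γ₁ * N) := by rw [hS]; field_simp; norm_num
      _ ≤ _ := by gcongr
  have ht : γ₁ / 40 * (N / Real.log x) * ((Icc 1 ⌊x⌋₊).card : ℝ) ≤ S := by
    rw [Nat.card_Icc, Nat.add_sub_cancel]
    exact mul_le_mul_of_nonneg_left (Nat.floor_le hx0.le) (by positivity)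
  have key := sq_le_card_mul_of_second_moment (Icc 1 ⌊x⌋₊) (fun n => (reprCount a n : ℝ))
    hS0 hmean ht hsecond
  have hD : 0 < N + ρ * Real.log x := by positivity
  have hQ : 0 < K * (x * N / Real.log x ^ 2) * (N + ρ * Real.log x) := by positivity
  rw [← div_le_iff₀ hQ] at key
  refine le_trans (le_of_eq ?_) key
  rw [hS]
  field_simp
  norm_num

end Romanoff

/-! ### The main theorem. -/

theorem theorem6 :
    ∀ γ₁ : ℝ, 0 < γ₁ → ∃ c₁ : ℝ, 0 < c₁ ∧
      ∀ γ₂ α : ℝ, 0 < γ₂ → 0 < α → ∃ c₂ : ℝ, 0 < c₂ ∧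
        ∀ (a : ℕ → ℕ) (x₀ : ℝ),
          (∀ j : ℕ, 0 < a j) →
          (∀ n : ℕ, 0 < n → {j : ℕ | a j = n}.Finite) →
          10 ≤ x₀ →
          (∀ x : ℝ, x₀ ≤ x →
            0 < Romanoff.countUpTo a x ∧
            γ₁ * (Romanoff.countUpTo a x : ℝ) ≤ (Romanoff.countUpTo a (x / 2) : ℝ) ∧
            Romanoff.smallPrimeSum a α x ≤ γ₂ * (Romanoff.countUpTo a x : ℝ) ^ 2) →
          ∀ x : ℝ, x₀ ≤ x →
            c₂ * x * ((Romanoff.countUpTo a x : ℝ) /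
                ((Romanoff.countUpTo a x : ℝ) +
                  (Romanoff.maxMultiplicity a x : ℝ) * Real.log x)) ≤
              ({n : ℕ | 1 ≤ n ∧ (n : ℝ) ≤ x ∧
                c₁ * ((Romanoff.countUpTo a x : ℝ) / Real.log x) ≤
                  (Romanoff.reprCount a n : ℝ)}.ncard : ℝ) ∧
            c₂ * x * ((Romanoff.countUpTo a x : ℝ) /
                ((Romanoff.countUpTo a x : ℝ) +
                  (Romanoff.maxMultiplicity a x : ℝ) * Real.log x)) ≤
              ({n : ℕ | 1 ≤ n ∧ (n : ℝ) ≤ x ∧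
                ∃ p j : ℕ, p.Prime ∧ p + a j = n}.ncard : ℝ) := by
  intro γ₁ hγ₁
  refine ⟨γ₁ / 40, by positivity, fun γ₂ α hγ₂ hα =>
    ⟨γ₁ ^ 2 / (1600 * (5 + 8256 * Real.exp (2 + 3 / α) * (2 + 4 * γ₂))),
      by have := Real.exp_pos (2 + 3 / α); positivity, fun a x₀ hpos hfin hx₀ hyp x hx => ?_⟩⟩
  obtain ⟨hN, hhalf, hsmall⟩ := hyp x hx
  have hx10 : 10 ≤ x := hx₀.trans hx
  have hL := Romanoff.two_le_log hx10
  have hJ : ∀ j, j ∈ (Romanoff.finite_setOf_le hfin hpos x).toFinset ↔ (a j : ℝ) ≤ x := by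
    intro j; simp
  have key := Romanoff.card_filter_reprCount_ge hpos hx10 hJ hα hγ₁ hγ₂ hN hhalf hsmall
  have hset : {n : ℕ | 1 ≤ n ∧ (n : ℝ) ≤ x ∧
      γ₁ / 40 * ((Romanoff.countUpTo a x : ℝ) / Real.log x) ≤ (Romanoff.reprCount a n : ℝ)} =
      ((Finset.Icc 1 ⌊x⌋₊).filter fun n =>
        γ₁ / 40 * ((Romanoff.countUpTo a x : ℝ) / Real.log x) ≤ (Romanoff.reprCount a n : ℝ) :
        Finset ℕ) := by
    ext n
    simp [Nat.le_floor_iff (show 0 ≤ x by linarith), and_assoc]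
  have hfirst : γ₁ ^ 2 / (1600 * (5 + 8256 * Real.exp (2 + 3 / α) * (2 + 4 * γ₂))) * x *
      ((Romanoff.countUpTo a x : ℝ) / ((Romanoff.countUpTo a x : ℝ) +
        (Romanoff.maxMultiplicity a x : ℝ) * Real.log x)) ≤
      ({n : ℕ | 1 ≤ n ∧ (n : ℝ) ≤ x ∧ γ₁ / 40 * ((Romanoff.countUpTo a x : ℝ) / Real.log x) ≤
        (Romanoff.reprCount a n : ℝ)}.ncard : ℝ) := by
    rw [hset, Set.ncard_coe_finset]
    exact key
  refine ⟨hfirst, hfirst.trans (Nat.cast_le.2 (Set.ncard_le_ncard ?_ ?_))⟩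
  -- Since N > 0, the threshold is positive, so r(n) ≠ 0 and a representation exists.
  · rintro n ⟨h1, h2, h3⟩
    refine ⟨h1, h2, ?_⟩
    have hN' : (0 : ℝ) < Romanoff.countUpTo a x := by exact_mod_cast hN
    have h4 : (0 : ℝ) < Romanoff.reprCount a n := lt_of_lt_of_le (by positivity) h3
    have h5 : 0 < Romanoff.reprCount a n := by exact_mod_cast h4
    obtain ⟨⟨p, j⟩, hpj⟩ := Set.nonempty_of_ncard_ne_zero h5.ne'
    exact ⟨p, j, hpj.1, hpj.2⟩
  · refine (Set.finite_Icc 1 ⌊x⌋₊).subset fun n hn => ?_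
    exact ⟨hn.1, Nat.le_floor hn.2.1⟩
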